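/- Let $\mathbb{R}^5_1=(\mathbb{R}^5,\langle\cdot,\cdot\rangle)$ with $\langle \bar x,\bar y\rangle=\sum_{i=1}^4x^iy^i-x^5y^5$, with flat connection $\hat\nabla$, and let $\mathbb{H}^4=\{\bar x\in\mathbb{R}^5_1:\langle\bar x,\bar x\rangle=-1,\ x^5>0\}$, with inclusion $\iota:\mathbb{H}^4\to\mathbb{R}^5_1$. Let $M^2$ be a connected oriented surface and $\varphi:M^2\to\mathbb{H}^4$ a smooth isometric immersion, with mean curvature vector field $H=\frac12\operatorname{trace}B$ and mean curvature function $f=|H|$. Assume that $\varphi$ is a PNMC biconservative immersion, i.e. - $f>0$ and $\operatorname{grad}f\neq0$ at every point, and $\nabla^\perp(H/f)=0$; - no non-empty open subset of $M$ is mapped into a totally geodesic hypersurface $\mathbb{H}^3\subset\mathbb{H}^4$; - the tangential part of the bitension field $\tau_2(\varphi)=-\Delta^\varphi\tau(\varphi)-\operatorname{trace}R^{\mathbb{H}^4}(\varphi_*\,\cdot,\tau(\varphi))\varphi_*\,\cdot$, where $\tau(\varphi)=2H$ and $\Delta^\varphi=-\operatorname{trace}(\nabla^\varphi\nabla^\varphi-\nabla^\varphi_\nabla)$,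 vanishes. Put $\Phi=\iota\circ\varphi$ and $E_1=\operatorname{grad}f/|\operatorname{grad}f|$, and let $E_2$ be the smooth vector field for which $\{E_1,E_2\}$ is a positively oriented orthonormal frame field of $TM$; identify tangent vectors $X$ of $M$ with $\Phi_*X$. Put $\hat\kappa=\sqrt{|\langle\hat\nabla_{E_2}E_2,\hat\nabla_{E_2}E_2\rangle|}$. Assume that $\hat\nabla_{E_2}E_2$ is timelike at every point of $M$. Let $\gamma:J\to M$ be an integral curve of $E_2$, defined on an open interval $J\ni0$, and let $\hat\gamma=\Phi\circ\gamma$. Then: (i) $\hat\kappa$ is a positive constant along $\hat\gamma$, and it is the curvature $\sqrt{|\langle\hat\gamma'',\hat\gamma''\rangle|}$ of $\hat\gamma$; (ii) the vector field $\xi=\frac1{\hat\kappa}\hat\nabla_{E_2}E_2$ satisfies $\hat\nabla_{E_2}\xi=\hat\kappa E_2$ on $M$; (iii) for all $v\in J$, $$\hat\gamma(v)=\overline B_0+\sinh(\hat\kappa v)\overline B_1+\cosh(\hat\kappa v)\overline B_2,$$ where $\hat\kappa$ denotes its constant value along $\hat\gamma$, $$\overline B_0=\hat\gamma(0)-\tfrac1{\hat\kappa}\xi(\gamma(0)),\qquad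 \overline B_1=\tfrac1{\hat\kappa}E_2(\gamma(0)),\qquad \overline B_2=\tfrac1{\hat\kappa}\xi(\gamma(0)),$$ and $$\langle\overline B_1,\overline B_2\rangle=0,\qquad \langle\overline B_1,\overline B_1\rangle=-\langle\overline B_2,\overline B_2\rangle=\frac1{\hat\kappa^2}.$$ In particular, $\hat\gamma$ lies in the affine plane $\overline B_0+\operatorname{span}\{\overline B_1,\overline B_2\}$, whose direction is Lorentzian (of signature $(1,1)$), and in the branch $\{\overline B_0+x\overline B_1+y\overline B_2:\ y^2-x^2=1,\ y>0\}$ of a hyperbola; if $J=\mathbb{R}$, then the image of $\hat\gamma$ is this whole branch. -/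

import Mathlib

open scoped Manifold ContDiff

noncomputable section

/-! ### Minkowski space and the hyperboloid model -/

/-- The underlying smooth vector space `ℝ⁵` of the Minkowski space `ℝ⁵₁`. -/
abbrev Mink5 : Type := EuclideanSpace ℝ (Fin 5)

/-- The Lorentzian scalar product `⟨x, y⟩ = x¹y¹ + x²y² + x³y³ + x⁴y⁴ - x⁵y⁵`. -/
def mink (x y : Mink5) : ℝ :=
  (∑ i : Fin 4, x i.castSucc * y i.castSucc) - x (Fin.last 4) * y (Fin.last 4)

/-- The hyperboloid model of the hyperbolic space `ℍ⁴`. -/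
def hyperbolicSpace4 : Set Mink5 := {x | mink x x = -1 ∧ 0 < x (Fin.last 4)}

/-- The totally geodesic hypersurfaces `ℍ³` of `ℍ⁴`: the intersections of `ℍ⁴` with the linear
hyperplanes that have a spacelike normal. -/
def IsTotallyGeodesicH3 (S : Set Mink5) : Prop :=
  ∃ ν : Mink5, 0 < mink ν ν ∧ S = {x | x ∈ hyperbolicSpace4 ∧ mink x ν = 0}

/-- The curvature tensor `R(X, Y)Z` of `ℍ⁴` (constant sectional curvature `-1`), with the
convention `R(X, Y)Z = [∇_X, ∇_Y]Z - ∇_{[X, Y]}Z`. -/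
def hypCurvature (X Y Z : Mink5) : Mink5 := -(mink Y Z • X - mink X Z • Y)

/-- A two-dimensional linear subspace on which the scalar product has signature `(1, 1)`. -/
def IsLorentzianPlane (P : Submodule ℝ Mink5) : Prop :=
  Module.finrank ℝ P = 2 ∧
    ∃ a b : Mink5, P = Submodule.span ℝ {a, b} ∧ mink a a = 1 ∧ mink b b = -1 ∧ mink a b = 0

/-- The branch `y > 0` of the hyperbola `y² - x² = 1`, in the affine coordinates `(x, y)` with
origin `c` and axis vectors `a`, `b`. -/
def hyperbolaBranch (c a b : Mink5) : Set Mink5 :=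
  {q | ∃ x y : ℝ, y ^ 2 - x ^ 2 = 1 ∧ 0 < y ∧ q = c + x • a + y • b}

/-- The curvature `√|⟨c'', c''⟩|` of a curve in `ℝ⁵₁` parametrized by arc length. -/
def curveCurvature (c : ℝ → Mink5) (v : ℝ) : ℝ :=
  √|mink (deriv (deriv c) v) (deriv (deriv c) v)|

/-! ### Geometry of a surface `Φ : M → ℍ⁴ ⊂ ℝ⁵₁` -/

section Surface

variable {M : Type*} [TopologicalSpace M] [ChartedSpace (EuclideanSpace ℝ (Fin 2)) M]

/-- Vector fields `X ∈ C(TM)`. -/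
abbrev VField (M : Type*) [TopologicalSpace M] [ChartedSpace (EuclideanSpace ℝ (Fin 2)) M] :
    Type _ :=
  (p : M) → TangentSpace (𝓡 2) p

/-- The tangent vector `v`, viewed as the vector `Φ_* v` of `ℝ⁵₁`. -/
def pushVec (Φ : M → Mink5) (p : M) (v : TangentSpace (𝓡 2) p) : Mink5 :=
  mvfderiv (𝓡 2) Φ p v

/-- The Riemannian metric on `M` induced by `Φ`. -/
def inducedMetric (Φ : M → Mink5) (p : M) (v w : TangentSpace (𝓡 2) p) : ℝ :=
  mink (pushVec Φ p v) (pushVec Φ p w)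

/-- An orthonormal basis of `T_pM` for the induced metric. -/
def IsOrthonormalBasisAt (Φ : M → Mink5) (p : M) (u : Fin 2 → TangentSpace (𝓡 2) p) : Prop :=
  ∀ i j, inducedMetric Φ p (u i) (u j) = if i = j then 1 else 0

/-- Some orthonormal basis of `T_pM`. It is used below only for traces and orthogonal projections,
which do not depend on the choice. -/
def orthoBasis (Φ : M → Mink5) (p : M) : Fin 2 → TangentSpace (𝓡 2) p :=
  Classical.epsilon (IsOrthonormalBasisAt Φ p)

/-- The tangent vector `v ∈ T_pM` whose image `Φ_* v` is the tangential component of `w ∈ ℝ⁵₁`. -/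
def tangentPart (Φ : M → Mink5) (p : M) (w : Mink5) : TangentSpace (𝓡 2) p :=
  ∑ i, mink w (pushVec Φ p (orthoBasis Φ p i)) • orthoBasis Φ p i

/-- The gradient of a function on `M` for the induced metric. -/
def gradM (Φ : M → Mink5) (h : M → ℝ) (p : M) : TangentSpace (𝓡 2) p :=
  ∑ i, (mvfderiv (𝓡 2) h p (orthoBasis Φ p i)) • orthoBasis Φ p i

/-- `∇̂_v V`: the flat connection of `ℝ⁵₁`, on vector fields `V : M → ℝ⁵₁` along `Φ`. -/
def covHat (V : M → Mink5) (p : M) (v : TangentSpace (𝓡 2) p) : Mink5 :=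
  mvfderiv (𝓡 2) V p v

/-- `∇̃_v V`: the Levi-Civita connection of `ℍ⁴`, on sections `V` of `φ⁻¹(Tℍ⁴)`. It is the
component of `∇̂_v V` orthogonal to the timelike unit normal `Φ` of `ℍ⁴`. -/
def covTilde (Φ : M → Mink5) (V : M → Mink5) (p : M) (v : TangentSpace (𝓡 2) p) : Mink5 :=
  covHat V p v + mink (covHat V p v) (Φ p) • Φ p

/-- `∇_v Y`: the Levi-Civita connection of the induced metric on `M`, that is, the tangential
component of the ambient derivative. -/
def covM (Φ : M → Mink5) (Y : VField M) (p : M) (v : TangentSpace (𝓡 2) p) :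
    TangentSpace (𝓡 2) p :=
  tangentPart Φ p (covHat (fun q => pushVec Φ q (Y q)) p v)

/-- `∇^⊥_v V`: the normal connection of `M` in `ℍ⁴`, on sections `V` of the normal bundle. -/
def covPerp (Φ : M → Mink5) (V : M → Mink5) (p : M) (v : TangentSpace (𝓡 2) p) : Mink5 :=
  covTilde Φ V p v - pushVec Φ p (tangentPart Φ p (covTilde Φ V p v))

variable [IsManifold (𝓡 2) ∞ M]

/-- An extension of a tangent vector at `p` to a vector field that is smooth near `p` (with
constant components in the chart at `p`). It is used below only in expressions that are tensorial,
so that the choice of the extension is immaterial. -/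
def extendVec {p : M} (v : TangentSpace (𝓡 2) p) : VField M :=
  haveI : IsManifold (𝓡 2) 1 M := IsManifold.of_le (n := ∞) (by simp)
  FiberBundle.extend (EuclideanSpace ℝ (Fin 2)) v

/-- The second fundamental form of `M` in `ℍ⁴`: `B(v, w) = ∇̃_v Φ_*W - Φ_*(∇_v W)`, for any
vector field `W` that extends `w`. -/
def secondFF (Φ : M → Mink5) (p : M) (v w : TangentSpace (𝓡 2) p) : Mink5 :=
  covTilde Φ (fun q => pushVec Φ q (extendVec w q)) p v - pushVec Φ p (covM Φ (extendVec w) p v)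

/-- The tension field `τ(φ) = trace B` of the isometric immersion `φ`. -/
def tensionField (Φ : M → Mink5) (p : M) : Mink5 :=
  ∑ i, secondFF Φ p (orthoBasis Φ p i) (orthoBasis Φ p i)

/-- The mean curvature vector field `H = (trace B) / 2`. -/
def meanCurvatureVector (Φ : M → Mink5) (p : M) : Mink5 := (1 / 2 : ℝ) • tensionField Φ p

/-- The mean curvature function `f = |H|`. -/
def meanCurvature (Φ : M → Mink5) (p : M) : ℝ :=
  √(mink (meanCurvatureVector Φ p) (meanCurvatureVector Φ p))

/-- The normalized mean curvature vector field `E₃ = H / f`. -/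
def normalizedMeanCurvature (Φ : M → Mink5) (p : M) : Mink5 :=
  (meanCurvature Φ p)⁻¹ • meanCurvatureVector Φ p

/-- The second covariant derivative `∇^φ_v ∇^φ_W V - ∇^φ_{∇_v W} V` of a section `V` of
`φ⁻¹(Tℍ⁴)`, for any vector field `W` that extends `w`. -/
def secondCov (Φ : M → Mink5) (V : M → Mink5) (p : M) (v w : TangentSpace (𝓡 2) p) : Mink5 :=
  covTilde Φ (fun q => covTilde Φ V q (extendVec w q)) p v -
    covTilde Φ V p (covM Φ (extendVec w) p v)

/-- The rough Laplacian `Δ^φ = -trace(∇^φ∇^φ - ∇^φ_∇)` on sections of `φ⁻¹(Tℍ⁴)`. -/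
def roughLaplacian (Φ : M → Mink5) (V : M → Mink5) (p : M) : Mink5 :=
  -∑ i, secondCov Φ V p (orthoBasis Φ p i) (orthoBasis Φ p i)

/-- The bitension field `τ₂(φ) = -Δ^φ τ(φ) - trace R(φ_*·, τ(φ))φ_*·`. -/
def bitensionField (Φ : M → Mink5) (p : M) : Mink5 :=
  -roughLaplacian Φ (tensionField Φ) p -
    ∑ i, hypCurvature (pushVec Φ p (orthoBasis Φ p i)) (tensionField Φ p)
      (pushVec Φ p (orthoBasis Φ p i))

/-- `Φ = ι ∘ φ` for a PNMC biconservative immersion `φ : M² → ℍ⁴`: a smooth immersion with values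
in `ℍ⁴`, with positive mean curvature function whose gradient vanishes nowhere, with parallel
normalized mean curvature vector field, with no nonempty open piece in a totally geodesic `ℍ³`,
and with `τ₂(φ)^⊤ = 0`. The metric on `M` is the induced one. -/
structure IsPNMCBiconservative (Φ : M → Mink5) : Prop where
  smooth : ContMDiff (𝓡 2) 𝓘(ℝ, Mink5) ∞ Φ
  mem_hyperbolicSpace : ∀ p, Φ p ∈ hyperbolicSpace4
  immersion : ∀ p, Function.Injective (pushVec Φ p)
  meanCurvature_pos : ∀ p, 0 < meanCurvature Φ p
  grad_ne_zero : ∀ p, gradM Φ (meanCurvature Φ) p ≠ 0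
  parallel : ∀ p, ∀ v : TangentSpace (𝓡 2) p, covPerp Φ (normalizedMeanCurvature Φ) p v = 0
  full : ∀ U : Set M, IsOpen U → U.Nonempty →
    ∀ S : Set Mink5, IsTotallyGeodesicH3 S → ¬ Φ '' U ⊆ S
  biconservative : ∀ p, tangentPart Φ p (bitensionField Φ p) = 0

/-- `E₁ = grad f / |grad f|`. -/
def frameE1 (Φ : M → Mink5) : VField M := fun p =>
  (√(inducedMetric Φ p (gradM Φ (meanCurvature Φ) p) (gradM Φ (meanCurvature Φ) p)))⁻¹ •
    gradM Φ (meanCurvature Φ) p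

/-- `E₂` is a smooth vector field that completes `E₁` to an orthonormal frame field `{E₁, E₂}` of
`TM`. Such a field exists exactly when `M` is orientable, and an orientation of `M` amounts to the
choice of the `E₂` that makes `{E₁, E₂}` positively oriented. -/
structure IsFrameE2 (Φ : M → Mink5) (E₂ : VField M) : Prop where
  smooth : ContMDiff (𝓡 2) (𝓡 2).tangent ∞ (fun p => (⟨p, E₂ p⟩ : TangentBundle (𝓡 2) M))
  unit : ∀ p, inducedMetric Φ p (E₂ p) (E₂ p) = 1
  orthogonal : ∀ p, inducedMetric Φ p (frameE1 Φ p) (E₂ p) = 0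

end Surface

section CurvatureField

variable {M : Type*} [TopologicalSpace M] [ChartedSpace (EuclideanSpace ℝ (Fin 2)) M]

/-- The vector field `∇̂_{E₂} E₂` along `Φ`. -/
def accelE2 (Φ : M → Mink5) (E₂ : VField M) (p : M) : Mink5 :=
  covHat (fun q => pushVec Φ q (E₂ q)) p (E₂ p)

/-- `κ̂ = √|⟨∇̂_{E₂} E₂, ∇̂_{E₂} E₂⟩|`. -/
def kappaHat (Φ : M → Mink5) (E₂ : VField M) (p : M) : ℝ :=
  √|mink (accelE2 Φ E₂ p) (accelE2 Φ E₂ p)|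

/-- `ξ = (1 / κ̂) ∇̂_{E₂} E₂`. -/
def xiField (Φ : M → Mink5) (E₂ : VField M) (p : M) : Mink5 :=
  (kappaHat Φ E₂ p)⁻¹ • accelE2 Φ E₂ p

end CurvatureField

end

/-! Let `X` be a unit field along grad f, `Y = E₂` and `n = H / f`. Since `n` is parallel in the
normal bundle, `S : Z ↦ ∇̂_Z n` is tangent-valued; it is symmetric with trace `-2f`. The tangential
part of the bitension equation reads `2f div S + 4 S(grad f) = 0`, and the Codazzi equation gives
`div S = grad (tr S) = -2 grad f`. Hence `S(grad f) = f grad f`, so `∇̂_X n = f X` and `∇̂_Y n = -3f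
Y` (`shape_off_diagonal_and_left`).

Commuting the two derivatives of `n`, as vectors of `ℝ⁵₁`, makes `∇̂_X Y` a multiple of `Y`; being
also orthogonal to `Y`, it is zero. The same identity gives `∇̂_Y X = w Y` with `w = -(3/4) X(f) /
f` (`along_left_right_and_coeff`). Since `Y(f) = Y(w) = 0`, solving the tension equation for `W =
∇̂_Y Y` expresses it through `Φ`, `X`, `n` and `∇̂_X X` in such a way that every term has
`Y`-derivative proportional to `Y`. Differentiating `⟨W, Y⟩ = 0` identifies the factor: `∇̂_Y W =
-⟨W, W⟩ Y` (`along_right_accel`). No frame of the second normal direction is needed.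

For timelike `W` it follows that `κ̂` is constant along `E₂` and that `∇̂_Y ξ = κ̂ Y`. Along an
integral curve this is the linear system `c' = T`, `T' = κ ξ`, `ξ' = κ T`, solved in
`HasDerivAt.eq_sinh_cosh`. -/

open Filter Topology

/-! ### The Lorentzian scalar product -/

section Minkowski

theorem mink_comm (x y : Mink5) : mink x y = mink y x := by
  simp [mink, mul_comm]

theorem mink_add_left (x y z : Mink5) : mink (x + y) z = mink x z + mink y z := by
  simp [mink, Fin.sum_univ_four]; ring

theorem mink_smul_left (c : ℝ) (x y : Mink5) : mink (c • x) y = c * mink x y := by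
  simp [mink, Fin.sum_univ_four]; ring

theorem mink_add_right (x y z : Mink5) : mink x (y + z) = mink x y + mink x z := by
  simp [mink, Fin.sum_univ_four]; ring

theorem mink_smul_right (c : ℝ) (x y : Mink5) : mink x (c • y) = c * mink x y := by
  simp [mink, Fin.sum_univ_four]; ring

theorem mink_neg_left (x y : Mink5) : mink (-x) y = -mink x y := by
  simp [mink, Fin.sum_univ_four]; ring

theorem mink_sub_left (x y z : Mink5) : mink (x - y) z = mink x z - mink y z := by
  simp [mink, Fin.sum_univ_four]; ring

theorem mink_zero_left (x : Mink5) : mink 0 x = 0 := by simp [mink]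

/-- Cauchy–Schwarz for the spatial parts, in the form of Lagrange's identity: with `|x|² = x4² - 1`
and `w · x = w4 x4` it gives `|w|² (x4² - 1) ≥ w4² x4² ≥ |w|² x4²`, which forces `|w|² ≤ 0`. -/
theorem lorentz_nonpos_eq_zero {w0 w1 w2 w3 w4 x0 x1 x2 x3 x4 : ℝ}
    (hx : x0 * x0 + x1 * x1 + x2 * x2 + x3 * x3 - x4 * x4 = -1)
    (hxw : w0 * x0 + w1 * x1 + w2 * x2 + w3 * x3 - w4 * x4 = 0)
    (hw : w0 * w0 + w1 * w1 + w2 * w2 + w3 * w3 - w4 * w4 ≤ 0) :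
    (w0 = 0 ∧ w1 = 0 ∧ w2 = 0 ∧ w3 = 0) ∧ w4 = 0 := by
  have hid : (w0 ^ 2 + w1 ^ 2 + w2 ^ 2 + w3 ^ 2) * (x0 ^ 2 + x1 ^ 2 + x2 ^ 2 + x3 ^ 2) -
      (w0 * x0 + w1 * x1 + w2 * x2 + w3 * x3) ^ 2 = (w0 * x1 - w1 * x0) ^ 2 +
      (w0 * x2 - w2 * x0) ^ 2 + (w0 * x3 - w3 * x0) ^ 2 + (w1 * x2 - w2 * x1) ^ 2 +
      (w1 * x3 - w3 * x1) ^ 2 + (w2 * x3 - w3 * x2) ^ 2 := by ring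
  have hpos : 0 ≤ (w0 * x1 - w1 * x0) ^ 2 +
      (w0 * x2 - w2 * x0) ^ 2 + (w0 * x3 - w3 * x0) ^ 2 + (w1 * x2 - w2 * x1) ^ 2 +
      (w1 * x3 - w3 * x1) ^ 2 + (w2 * x3 - w3 * x2) ^ 2 := by positivity
  have hs : w0 * x0 + w1 * x1 + w2 * x2 + w3 * x3 = w4 * x4 := by linarith
  have hx' : x0 ^ 2 + x1 ^ 2 + x2 ^ 2 + x3 ^ 2 = x4 ^ 2 - 1 := by linarith
  rw [← hid, hs, hx'] at hpos
  have hx4 : 1 ≤ x4 ^ 2 := by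
    have : 0 ≤ x0 ^ 2 + x1 ^ 2 + x2 ^ 2 + x3 ^ 2 := by positivity
    linarith
  have q0 := sq_nonneg w0
  have q1 := sq_nonneg w1
  have q2 := sq_nonneg w2
  have q3 := sq_nonneg w3
  have hS0 : w0 ^ 2 + w1 ^ 2 + w2 ^ 2 + w3 ^ 2 ≤ 0 := by
    have hS : 0 ≤ (w4 ^ 2 - (w0 ^ 2 + w1 ^ 2 + w2 ^ 2 + w3 ^ 2)) * x4 ^ 2 :=
      mul_nonneg (by linarith) (sq_nonneg _)
    linarith
  have e0 : w0 = 0 := pow_eq_zero_iff two_ne_zero |>.1 (by linarith)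
  have e1 : w1 = 0 := pow_eq_zero_iff two_ne_zero |>.1 (by linarith)
  have e2 : w2 = 0 := pow_eq_zero_iff two_ne_zero |>.1 (by linarith)
  have e3 : w3 = 0 := pow_eq_zero_iff two_ne_zero |>.1 (by linarith)
  refine ⟨⟨e0, e1, e2, e3⟩, ?_⟩
  have : w4 * x4 = 0 := by rw [← hs, e0, e1, e2, e3]; ring
  rcases mul_eq_zero.1 this with h | h
  · exact h
  · rw [h] at hx4; norm_num at hx4

/-- Tangent vectors of the hyperboloid are spacelike. -/
theorem mink_self_pos_of_orthogonal {x w : Mink5} (hx : mink x x = -1) (hxw : mink w x = 0)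
    (hw : w ≠ 0) : 0 < mink w w := by
  by_contra! hneg
  simp only [mink, Fin.sum_univ_four] at hx hxw hneg
  obtain ⟨⟨h0, h1, h2, h3⟩, h4⟩ := lorentz_nonpos_eq_zero hx hxw hneg
  apply hw
  ext i
  refine Fin.lastCases h4 (fun j => ?_) i
  fin_cases j
  exacts [h0, h1, h2, h3]

end Minkowski

/-! ### Differential calculus along vector fields -/

section Calculus

variable {M : Type*} [TopologicalSpace M] [ChartedSpace (EuclideanSpace ℝ (Fin 2)) M]
variable {F : Type*} [NormedAddCommGroup F] [NormedSpace ℝ F]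
variable {G : Type*} [NormedAddCommGroup G] [NormedSpace ℝ G]

/-- Smoothness at a point of a vector-valued function on `M`. -/
abbrev SmoothFnAt (V : M → F) (p : M) : Prop := ContMDiffAt (𝓡 2) 𝓘(ℝ, F) ∞ V p

theorem SmoothFnAt.mdiff {V : M → F} {p : M} (h : SmoothFnAt V p) :
    MDifferentiableAt (𝓡 2) 𝓘(ℝ, F) V p := ContMDiffAt.mdifferentiableAt h (by simp)

theorem SmoothFnAt.add {V W : M → F} {p : M} (hV : SmoothFnAt V p) (hW : SmoothFnAt W p) :
    SmoothFnAt (fun q => V q + W q) p := ContMDiffAt.add hV hW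

theorem SmoothFnAt.sub {V W : M → F} {p : M} (hV : SmoothFnAt V p) (hW : SmoothFnAt W p) :
    SmoothFnAt (fun q => V q - W q) p := ContMDiffAt.sub hV hW

theorem SmoothFnAt.smul {a : M → ℝ} {V : M → F} {p : M} (ha : SmoothFnAt a p)
    (hV : SmoothFnAt V p) : SmoothFnAt (fun q => a q • V q) p := ContMDiffAt.smul ha hV

theorem SmoothFnAt.mul {a b : M → ℝ} {p : M} (ha : SmoothFnAt a p)
    (hb : SmoothFnAt b p) : SmoothFnAt (fun q => a q * b q) p := ContMDiffAt.smul ha hb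

theorem SmoothFnAt.comp {g : F → G} {V : M → F} {p : M} (hg : ContDiffAt ℝ ∞ g (V p))
    (hV : SmoothFnAt V p) : SmoothFnAt (fun q => g (V q)) p :=
  ContMDiffAt.comp p hg.contMDiffAt hV

theorem SmoothFnAt.sqrt {a : M → ℝ} {p : M} (ha : SmoothFnAt a p) (h : a p ≠ 0) :
    SmoothFnAt (fun q => √(a q)) p :=
  SmoothFnAt.comp (g := Real.sqrt) (Real.contDiffAt_sqrt h) ha

theorem SmoothFnAt.inv {a : M → ℝ} {p : M} (ha : SmoothFnAt a p) (h : a p ≠ 0) :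
    SmoothFnAt (fun q => (a q)⁻¹) p :=
  SmoothFnAt.comp (g := fun x : ℝ => x⁻¹) (contDiffAt_inv ℝ h) ha

theorem contDiff_mink : ContDiff ℝ ∞ (fun z : Mink5 × Mink5 => mink z.1 z.2) := by
  unfold mink; fun_prop

theorem SmoothFnAt.mink {V W : M → Mink5} {p : M} (hV : SmoothFnAt V p) (hW : SmoothFnAt W p) :
    SmoothFnAt (fun q => mink (V q) (W q)) p := by
  have h : SmoothFnAt (fun q => (V q, W q)) p := ContMDiffAt.prodMk_space hV hW
  exact SmoothFnAt.comp (g := fun z : Mink5 × Mink5 => _root_.mink z.1 z.2)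
    contDiff_mink.contDiffAt h

theorem mvfderiv_comp_fderiv {g : F → G} {V : M → F} {p : M} (hg : DifferentiableAt ℝ g (V p))
    (hV : MDifferentiableAt (𝓡 2) 𝓘(ℝ, F) V p) (v : TangentSpace (𝓡 2) p) :
    mvfderiv (𝓡 2) (fun q => g (V q)) p v = fderiv ℝ g (V p) (mvfderiv (𝓡 2) V p v) := by
  have := mfderiv_comp_apply p hg.mdifferentiableAt hV v
  rw [mfderiv_eq_fderiv] at this
  exact this

theorem mvfderiv_clm_comp (L : F →L[ℝ] G) {V : M → F} {p : M}
    (hV : MDifferentiableAt (𝓡 2) 𝓘(ℝ, F) V p) (v : TangentSpace (𝓡 2) p) :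
    mvfderiv (𝓡 2) (fun q => L (V q)) p v = L (mvfderiv (𝓡 2) V p v) := by
  simpa using mvfderiv_comp_fderiv L.differentiableAt hV v

/-- Serves for second derivatives: in a chart, the derivative of a function along a field is an
operator-valued function applied to a vector-valued one. -/
theorem mvfderiv_clm_apply {A : M → F →L[ℝ] G} {V : M → F} {p : M}
    (hA : MDifferentiableAt (𝓡 2) 𝓘(ℝ, F →L[ℝ] G) A p)
    (hV : MDifferentiableAt (𝓡 2) 𝓘(ℝ, F) V p) (v : TangentSpace (𝓡 2) p) :
    mvfderiv (𝓡 2) (fun q => A q (V q)) p v =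
      mvfderiv (𝓡 2) A p v (V p) + A p (mvfderiv (𝓡 2) V p v) := by
  have hAV : MDifferentiableAt (𝓡 2) 𝓘(ℝ, G) (fun q => A q (V q)) p := hA.clm_apply hV
  rw [hA.mvfderiv, hV.mvfderiv, hAV.mvfderiv]
  have hA' := ((mdifferentiableAt_iff _ _).1 hA).2
  have hV' := ((mdifferentiableAt_iff _ _).1 hV).2
  have h := (hA'.hasFDerivWithinAt.clm_apply hV'.hasFDerivWithinAt).fderivWithin
    (by simp [uniqueDiffWithinAt_univ])
  have eA : writtenInExtChartAt (𝓡 2) 𝓘(ℝ, F →L[ℝ] G) p A (extChartAt (𝓡 2) p p) = A p := by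
    simp [writtenInExtChartAt]; rfl
  have eV : writtenInExtChartAt (𝓡 2) 𝓘(ℝ, F) p V (extChartAt (𝓡 2) p p) = V p := by
    simp [writtenInExtChartAt]; rfl
  rw [eA, eV] at h
  refine (congrArg (fun L : EuclideanSpace ℝ (Fin 2) →L[ℝ] G => L v) h).trans ?_
  exact add_comm _ _

theorem mvfderiv_congr {V W : M → F} {p : M} (h : V =ᶠ[𝓝 p] W) :
    mvfderiv (𝓡 2) V p = mvfderiv (𝓡 2) W p := by
  have h2 := h.mfderiv_eq (I := 𝓡 2) (I' := 𝓘(ℝ, F))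
  ext v
  exact congrArg (fun L => L v) h2

theorem mvfderiv_mink {V W : M → Mink5} {p : M} (hV : MDifferentiableAt (𝓡 2) 𝓘(ℝ, Mink5) V p)
    (hW : MDifferentiableAt (𝓡 2) 𝓘(ℝ, Mink5) W p) (v : TangentSpace (𝓡 2) p) :
    mvfderiv (𝓡 2) (fun q => mink (V q) (W q)) p v =
      mink (mvfderiv (𝓡 2) V p v) (W p) + mink (V p) (mvfderiv (𝓡 2) W p v) := by
  have hc (U : M → Mink5) (hU : MDifferentiableAt (𝓡 2) 𝓘(ℝ, Mink5) U p) (i : Fin 5) :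
      MDifferentiableAt (𝓡 2) 𝓘(ℝ, ℝ) (fun q => U q i) p :=
    (EuclideanSpace.proj (𝕜 := ℝ) i).differentiableAt.mdifferentiableAt.comp p hU
  have hd (U : M → Mink5) (hU : MDifferentiableAt (𝓡 2) 𝓘(ℝ, Mink5) U p) (i : Fin 5) :
      mvfderiv (𝓡 2) (fun q => U q i) p v = mvfderiv (𝓡 2) U p v i :=
    mvfderiv_clm_comp (EuclideanSpace.proj (𝕜 := ℝ) i) hU v
  have hm (i : Fin 5) : MDifferentiableAt (𝓡 2) 𝓘(ℝ, ℝ) (fun q => V q i * W q i) p :=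
    (hc V hV i).mul (hc W hW i)
  have ha {a b : M → ℝ} (h : MDifferentiableAt (𝓡 2) 𝓘(ℝ, ℝ) a p)
      (h' : MDifferentiableAt (𝓡 2) 𝓘(ℝ, ℝ) b p) :
      MDifferentiableAt (𝓡 2) 𝓘(ℝ, ℝ) (fun q => a q + b q) p := h.add h'
  have hp (i : Fin 5) : mvfderiv (𝓡 2) (fun q => V q i * W q i) p v =
      V p i * mvfderiv (𝓡 2) W p v i + W p i * mvfderiv (𝓡 2) V p v i := by
    rw [mvfderiv_fun_mul (hc V hV i) (hc W hW i)]
    simp [hd V hV, hd W hW]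
  simp only [mink, Fin.sum_univ_four]
  rw [mvfderiv_fun_sub (ha (ha (ha (hm _) (hm _)) (hm _)) (hm _)) (hm _),
    mvfderiv_fun_add (ha (ha (hm _) (hm _)) (hm _)) (hm _),
    mvfderiv_fun_add (ha (hm _) (hm _)) (hm _), mvfderiv_fun_add (hm _) (hm _)]
  simp only [sub_apply, add_apply, hp]
  ring

/-- The derivative of a vector-valued function along a vector field. -/
noncomputable def along (X : VField M) (V : M → F) (p : M) : F := mvfderiv (𝓡 2) V p (X p)

theorem along_congr {X : VField M} {V W : M → F} {p : M} (h : V =ᶠ[𝓝 p] W) :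
    along X V p = along X W p := by rw [along, along, mvfderiv_congr h]

theorem along_const (X : VField M) (c : F) (p : M) : along X (fun _ => c) p = 0 := by
  simp [along, mvfderiv_const]

theorem along_add {X : VField M} {V W : M → F} {p : M} (hV : SmoothFnAt V p)
    (hW : SmoothFnAt W p) : along X (fun q => V q + W q) p = along X V p + along X W p := by
  simp [along, mvfderiv_fun_add hV.mdiff hW.mdiff]

theorem along_sub {X : VField M} {V W : M → F} {p : M} (hV : SmoothFnAt V p)
    (hW : SmoothFnAt W p) : along X (fun q => V q - W q) p = along X V p - along X W p := by
  simp [along, mvfderiv_fun_sub hV.mdiff hW.mdiff]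

theorem along_smul {X : VField M} {a : M → ℝ} {V : M → F} {p : M} (ha : SmoothFnAt a p)
    (hV : SmoothFnAt V p) :
    along X (fun q => a q • V q) p = a p • along X V p + along X a p • V p := by
  simp [along, mvfderiv_fun_smul ha.mdiff hV.mdiff]

theorem along_mul {X : VField M} {a b : M → ℝ} {p : M} (ha : SmoothFnAt a p)
    (hb : SmoothFnAt b p) :
    along X (fun q => a q * b q) p = a p * along X b p + along X a p * b p := by
  simp [along, mvfderiv_fun_mul ha.mdiff hb.mdiff, mul_comm]

theorem along_mink {X : VField M} {V W : M → Mink5} {p : M} (hV : SmoothFnAt V p)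
    (hW : SmoothFnAt W p) :
    along X (fun q => mink (V q) (W q)) p =
      mink (along X V p) (W p) + mink (V p) (along X W p) :=
  mvfderiv_mink hV.mdiff hW.mdiff _

variable [IsManifold (𝓡 2) ∞ M]

/-- Smoothness at a point of a vector field. -/
abbrev SmoothVFieldAt (X : VField M) (p : M) : Prop :=
  ContMDiffAt (𝓡 2) (𝓡 2).tangent ∞ (fun p => (⟨p, X p⟩ : TangentBundle (𝓡 2) M)) p

theorem SmoothFnAt.mvfderiv_apply {X : VField M} {V : M → F} {p : M} (hV : SmoothFnAt V p)
    (hX : SmoothVFieldAt X p) : SmoothFnAt (fun q => mvfderiv (𝓡 2) V q (X q)) p := by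
  have h1 := ContMDiffAt.mfderiv_const (m := ∞) hV (by simp)
  have h2 := ContMDiffAt.clm_apply_of_inCoordinates (b₁ := id) (b₂ := V)
    (E₂ := TangentSpace 𝓘(ℝ, F)) (F₂ := F)
    (ϕ := fun q => mfderiv (𝓡 2) 𝓘(ℝ, F) V q) h1 hX hV
  rw [Bundle.contMDiffAt_totalSpace] at h2
  simpa using! h2.2

theorem SmoothFnAt.along {X : VField M} {V : M → F} {p : M} (hV : SmoothFnAt V p)
    (hX : SmoothVFieldAt X p) : SmoothFnAt (along X V) p := hV.mvfderiv_apply hX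

/-- The commutator of two vector fields acts on functions as a tangent vector. -/
theorem exists_commutator {X Y : VField M} {p : M} (hX : SmoothVFieldAt X p)
    (hY : SmoothVFieldAt Y p) : ∃ z : TangentSpace (𝓡 2) p,
      ∀ (F : Type) [NormedAddCommGroup F] [NormedSpace ℝ F] (V : M → F), SmoothFnAt V p →
      along X (along Y V) p - along Y (along X V) p = mvfderiv (𝓡 2) V p z := by
  -- Writing `V = v ∘ e` in the chart `e`, one has `X(Y V) = D²v(X e, Y e) + Dv(X(Y e))`. The
  -- Hessian term is symmetric, so only `Dv` of `X(Y e) - Y(X e)` survives; `z` is the preimage of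
  -- that vector under the invertible differential of `e`, and so is independent of `V`.
  set e : M → EuclideanSpace ℝ (Fin 2) := ⇑(extChartAt (𝓡 2) p) with he_def
  have he : SmoothFnAt e p := contMDiffAt_extChartAt
  have key (F : Type) [NormedAddCommGroup F] [NormedSpace ℝ F] (V : M → F)
      (hV : SmoothFnAt V p) (X Y : VField M) (hX : SmoothVFieldAt X p)
      (hY : SmoothVFieldAt Y p) : along X (along Y V) p =
        fderiv ℝ (fderiv ℝ (V ∘ (extChartAt (𝓡 2) p).symm)) (e p) (along X e p) (along Y e p) +
        fderiv ℝ (V ∘ (extChartAt (𝓡 2) p).symm) (e p) (along X (along Y e) p) := by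
    set v := V ∘ (extChartAt (𝓡 2) p).symm with hv_def
    have hv : ContDiffAt ℝ ∞ v (e p) := by
      have := (contMDiffAt_iff.1 hV).2
      simpa [he_def] using! this
    have hVe : V =ᶠ[𝓝 p] fun q => v (e q) := by
      filter_upwards [extChartAt_source_mem_nhds (I := 𝓡 2) p] with q hq
      exact congrArg V ((extChartAt (𝓡 2) p).left_inv hq).symm
    have hvev : ∀ᶠ q in 𝓝 p, DifferentiableAt ℝ v (e q) := by
      have h1 : ∀ᶠ x in 𝓝 (e p), ContDiffAt ℝ 1 v x :=
        (hv.of_le (m := 1) (by simp)).eventually (by simp)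
      filter_upwards [he.continuousAt.eventually h1] with q hq using hq.differentiableAt (by simp)
    have heev : ∀ᶠ q in 𝓝 p, SmoothFnAt e q := by
      filter_upwards [chart_source_mem_nhds (EuclideanSpace ℝ (Fin 2)) p] with q hq
      exact contMDiffAt_extChartAt' hq
    have hYV : along Y V =ᶠ[𝓝 p] fun q => fderiv ℝ v (e q) (along Y e q) := by
      filter_upwards [hVe.eventuallyEq_nhds, hvev, heev] with q h1 h2 h3
      rw [along_congr h1]
      exact mvfderiv_comp_fderiv h2 h3.mdiff _
    have hA : ContDiffAt ℝ ∞ (fderiv ℝ v) (e p) := hv.fderiv_right (by simp)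
    have hA' : SmoothFnAt (fun q => fderiv ℝ v (e q)) p := SmoothFnAt.comp hA he
    rw [along_congr hYV, along, mvfderiv_clm_apply hA'.mdiff (he.along hY).mdiff,
      mvfderiv_comp_fderiv (hA.differentiableAt (by simp)) he.mdiff]
    rfl
  have hinv := isInvertible_mfderiv_extChartAt (I := 𝓡 2) (mem_extChartAt_source (I := 𝓡 2) p)
  obtain ⟨z, hz⟩ : ∃ z : TangentSpace (𝓡 2) p,
      mvfderiv (𝓡 2) e p z = along X (along Y e) p - along Y (along X e) p :=
    hinv.bijective.surjective _
  refine ⟨z, fun F _ _ V hV => ?_⟩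
  have hv : ContDiffAt ℝ ∞ (V ∘ (extChartAt (𝓡 2) p).symm) (e p) := by
    have := (contMDiffAt_iff.1 hV).2
    simpa [he_def] using! this
  have hVe : V =ᶠ[𝓝 p] fun q => (V ∘ (extChartAt (𝓡 2) p).symm) (e q) := by
    filter_upwards [extChartAt_source_mem_nhds (I := 𝓡 2) p] with q hq
    exact congrArg V ((extChartAt (𝓡 2) p).left_inv hq).symm
  have hsymm := hv.isSymmSndFDerivAt (by simp; exact WithTop.coe_le_coe.2 le_top)
  rw [key F V hV X Y hX hY, key F V hV Y X hY hX, hsymm.eq, mvfderiv_congr hVe,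
    mvfderiv_comp_fderiv (hv.differentiableAt (by simp)) he.mdiff, hz, map_sub]
  abel

end Calculus

/-! ### Linear algebra of the induced metric -/

section InducedMetric

variable {M : Type*} [TopologicalSpace M] [ChartedSpace (EuclideanSpace ℝ (Fin 2)) M]
variable {Φ : M → Mink5} {p : M}

theorem pushVec_add (v w : TangentSpace (𝓡 2) p) :
    pushVec Φ p (v + w) = pushVec Φ p v + pushVec Φ p w := map_add _ _ _

theorem pushVec_smul (c : ℝ) (v : TangentSpace (𝓡 2) p) :
    pushVec Φ p (c • v) = c • pushVec Φ p v := map_smul _ _ _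

theorem inducedMetric_add_left (u v w : TangentSpace (𝓡 2) p) :
    inducedMetric Φ p (u + v) w = inducedMetric Φ p u w + inducedMetric Φ p v w := by
  simp [inducedMetric, pushVec_add, mink_add_left]

theorem inducedMetric_smul_left (c : ℝ) (v w : TangentSpace (𝓡 2) p) :
    inducedMetric Φ p (c • v) w = c * inducedMetric Φ p v w := by
  simp [inducedMetric, pushVec_smul, mink_smul_left]

theorem inducedMetric_comm (v w : TangentSpace (𝓡 2) p) :
    inducedMetric Φ p v w = inducedMetric Φ p w v := mink_comm _ _

theorem inducedMetric_smul_right (c : ℝ) (v w : TangentSpace (𝓡 2) p) :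
    inducedMetric Φ p v (c • w) = c * inducedMetric Φ p v w := by
  simp [inducedMetric, pushVec_smul, mink_smul_right]

variable {u : Fin 2 → TangentSpace (𝓡 2) p}

theorem IsOrthonormalBasisAt.eq_sum (hu : IsOrthonormalBasisAt Φ p u)
    (w : TangentSpace (𝓡 2) p) :
    w = inducedMetric Φ p w (u 0) • u 0 + inducedMetric Φ p w (u 1) • u 1 := by
  have h00 : inducedMetric Φ p (u 0) (u 0) = 1 := by simpa using hu 0 0
  have h01 : inducedMetric Φ p (u 0) (u 1) = 0 := by simpa using hu 0 1
  have h10 : inducedMetric Φ p (u 1) (u 0) = 0 := by simpa using hu 1 0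
  have h11 : inducedMetric Φ p (u 1) (u 1) = 1 := by simpa using hu 1 1
  have hz (v : TangentSpace (𝓡 2) p) : inducedMetric Φ p 0 v = 0 := by
    simpa using inducedMetric_smul_left (Φ := Φ) 0 0 v
  have hli : LinearIndependent ℝ u := by
    rw [Fintype.linearIndependent_iff]
    intro g hg
    rw [Fin.sum_univ_two] at hg
    have a0 := congrArg (fun x => inducedMetric Φ p x (u 0)) hg
    have a1 := congrArg (fun x => inducedMetric Φ p x (u 1)) hg
    simp only [inducedMetric_add_left, inducedMetric_smul_left, h00, h01, h10, h11, hz] at a0 a1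
    intro i
    fin_cases i
    · simpa using a0
    · simpa using a1
  have hcard : Fintype.card (Fin 2) = Module.finrank ℝ (TangentSpace (𝓡 2) p) := by
    rw [Fintype.card_fin]
    exact (finrank_euclideanSpace_fin (𝕜 := ℝ) (n := 2)).symm
  have : FiniteDimensional ℝ (TangentSpace (𝓡 2) p) :=
    inferInstanceAs (FiniteDimensional ℝ (EuclideanSpace ℝ (Fin 2)))
  have hspan : w ∈ Submodule.span ℝ (Set.range u) := by
    rw [hli.span_eq_top_of_card_eq_finrank' hcard]; trivial
  obtain ⟨c, hc⟩ := (Submodule.mem_span_range_iff_exists_fun ℝ).1 hspan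
  rw [Fin.sum_univ_two] at hc
  have a0 := congrArg (fun x => inducedMetric Φ p x (u 0)) hc
  have a1 := congrArg (fun x => inducedMetric Φ p x (u 1)) hc
  simp only [inducedMetric_add_left, inducedMetric_smul_left, h00, h01, h10, h11] at a0 a1
  rw [← a0, ← a1]
  simpa using hc.symm

theorem isOrthonormalBasisAt_orthoBasis (hu : IsOrthonormalBasisAt Φ p u) :
    IsOrthonormalBasisAt Φ p (orthoBasis Φ p) :=
  Classical.epsilon_spec ⟨u, hu⟩

/-- The trace of a bilinear form does not depend on the orthonormal basis. -/
theorem IsOrthonormalBasisAt.sum_orthoBasis {G : Type*} [AddCommGroup G] [Module ℝ G]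
    (hu : IsOrthonormalBasisAt Φ p u) {l₀ l₁ : TangentSpace (𝓡 2) p → G}
    (h₀ : IsLinearMap ℝ l₀) (h₁ : IsLinearMap ℝ l₁) :
    ∑ i, (inducedMetric Φ p (orthoBasis Φ p i) (u 0) • l₀ (orthoBasis Φ p i) +
      inducedMetric Φ p (orthoBasis Φ p i) (u 1) • l₁ (orthoBasis Φ p i)) =
      l₀ (u 0) + l₁ (u 1) := by
  have ho := isOrthonormalBasisAt_orthoBasis hu
  conv_rhs => rw [ho.eq_sum (u 0), ho.eq_sum (u 1)]
  rw [Fin.sum_univ_two, h₀.map_add, h₁.map_add, h₀.map_smul, h₀.map_smul, h₁.map_smul,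
    h₁.map_smul]
  simp only [inducedMetric_comm (u _)]
  abel

/-- The projection is characterised by its pairings with tangent vectors, and these do not see which
basis `orthoBasis` picked. -/
theorem IsOrthonormalBasisAt.tangentPart_eq (hu : IsOrthonormalBasisAt Φ p u) (w : Mink5) :
    tangentPart Φ p w = mink w (pushVec Φ p (u 0)) • u 0 + mink w (pushVec Φ p (u 1)) • u 1 := by
  have ho := isOrthonormalBasisAt_orthoBasis hu
  have key (v : TangentSpace (𝓡 2) p) :
      inducedMetric Φ p (tangentPart Φ p w) v = mink w (pushVec Φ p v) := by
    conv_rhs => rw [ho.eq_sum v]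
    rw [tangentPart, Fin.sum_univ_two, inducedMetric_add_left, inducedMetric_smul_left,
      inducedMetric_smul_left, pushVec_add, pushVec_smul, pushVec_smul, mink_add_right,
      mink_smul_right, mink_smul_right, inducedMetric_comm v, inducedMetric_comm v]
    ring
  rw [← key, ← key]
  exact hu.eq_sum _

theorem inducedMetric_gradM (hu : IsOrthonormalBasisAt Φ p u) (h : M → ℝ)
    (v : TangentSpace (𝓡 2) p) : inducedMetric Φ p (gradM Φ h p) v = mvfderiv (𝓡 2) h p v := by
  have ho := isOrthonormalBasisAt_orthoBasis hu
  conv_rhs => rw [ho.eq_sum v]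
  rw [gradM, Fin.sum_univ_two, inducedMetric_add_left, inducedMetric_smul_left,
    inducedMetric_smul_left, map_add, map_smul, map_smul, inducedMetric_comm v,
    inducedMetric_comm v]
  simp only [smul_eq_mul]
  ring

end InducedMetric

/-! ### Local orthonormal frame fields -/

section Frame

variable {M : Type*} [TopologicalSpace M] [ChartedSpace (EuclideanSpace ℝ (Fin 2)) M]

/-- The component of a vector of `ℝ⁵₁` that is tangent to `ℍ⁴`. -/
noncomputable def hypPart (Φ : M → Mink5) (p : M) (x : Mink5) : Mink5 :=
  x + mink x (Φ p) • Φ p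

/-- The component of a vector of `ℝ⁵₁` that is tangent to `ℍ⁴` and normal to the surface. -/
noncomputable def normalPart (Φ : M → Mink5) (p : M) (x : Mink5) : Mink5 :=
  hypPart Φ p x - pushVec Φ p (tangentPart Φ p x)

variable [IsManifold (𝓡 2) ∞ M]

theorem smoothVFieldAt_extendVec {p : M} (v : TangentSpace (𝓡 2) p) :
    SmoothVFieldAt (extendVec v) p :=
  FiberBundle.contMDiffAt_extend (𝓡 2) (EuclideanSpace ℝ (Fin 2)) v

theorem extendVec_self {p : M} (v : TangentSpace (𝓡 2) p) : extendVec v p = v :=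
  FiberBundle.extend_apply_self (F := EuclideanSpace ℝ (Fin 2)) v

/-- `{X, Y}` is a smooth orthonormal frame field on the open set `U` for the metric induced by the
map `Φ` into the hyperboloid. -/
structure IsOrthonormalFrameOn (Φ : M → Mink5) (X Y : VField M) (U : Set M) : Prop where
  isOpen : IsOpen U
  smooth_map : ∀ q ∈ U, SmoothFnAt Φ q
  smooth_left : ∀ q ∈ U, SmoothVFieldAt X q
  smooth_right : ∀ q ∈ U, SmoothVFieldAt Y q
  mink_self : ∀ q ∈ U, mink (Φ q) (Φ q) = -1
  left_left : ∀ q ∈ U, mink (along X Φ q) (along X Φ q) = 1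
  left_right : ∀ q ∈ U, mink (along X Φ q) (along Y Φ q) = 0
  right_right : ∀ q ∈ U, mink (along Y Φ q) (along Y Φ q) = 1

namespace IsOrthonormalFrameOn

variable {Φ : M → Mink5} {X Y : VField M} {U : Set M} (h : IsOrthonormalFrameOn Φ X Y U)
  {q : M} (hq : q ∈ U)
include h hq

theorem eventually {P : M → Prop} (hP : ∀ r ∈ U, P r) : ∀ᶠ r in 𝓝 q, P r :=
  Filter.Eventually.mono (h.isOpen.eventually_mem hq) hP

theorem smooth_along_left : SmoothFnAt (along X Φ) q :=
  (h.smooth_map q hq).along (h.smooth_left q hq)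

theorem smooth_along_right : SmoothFnAt (along Y Φ) q :=
  (h.smooth_map q hq).along (h.smooth_right q hq)

theorem isOrthonormalBasisAt : IsOrthonormalBasisAt Φ q ![X q, Y q] := by
  intro i j
  have h1 := h.left_left q hq
  have h2 := h.left_right q hq
  have h3 := h.right_right q hq
  fin_cases i <;> fin_cases j <;>
    first
      | simpa [inducedMetric, pushVec] using! h1
      | simpa [inducedMetric, pushVec] using! h2
      | simpa [inducedMetric, pushVec] using! h3
      | simpa [inducedMetric, pushVec] using! (mink_comm _ _).trans h2

theorem eq_sum (w : TangentSpace (𝓡 2) q) :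
    w = mink (pushVec Φ q w) (along X Φ q) • X q + mink (pushVec Φ q w) (along Y Φ q) • Y q :=
  (h.isOrthonormalBasisAt hq).eq_sum w

theorem tangentPart_eq (x : Mink5) :
    tangentPart Φ q x = mink x (along X Φ q) • X q + mink x (along Y Φ q) • Y q :=
  (h.isOrthonormalBasisAt hq).tangentPart_eq x

theorem pushVec_tangentPart (x : Mink5) : pushVec Φ q (tangentPart Φ q x) =
    mink x (along X Φ q) • along X Φ q + mink x (along Y Φ q) • along Y Φ q := by
  rw [h.tangentPart_eq hq, pushVec_add, pushVec_smul, pushVec_smul]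
  rfl

theorem normalPart_eq (x : Mink5) : normalPart Φ q x = x + mink x (Φ q) • Φ q -
    (mink x (along X Φ q) • along X Φ q + mink x (along Y Φ q) • along Y Φ q) := by
  rw [normalPart, hypPart, h.pushVec_tangentPart hq]

theorem mink_along_map {Z : VField M} : mink (along Z Φ q) (Φ q) = 0 := by
  have h1 : along Z (fun r => mink (Φ r) (Φ r)) q = 0 := by
    rw [along_congr (W := fun _ => (-1 : ℝ)) (h.eventually hq h.mink_self), along_const]
  rw [along_mink (h.smooth_map q hq) (h.smooth_map q hq), mink_comm (Φ q)] at h1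
  linarith

theorem isLinearMap_normalPart : IsLinearMap ℝ (normalPart Φ q) where
  map_add x y := by
    simp only [h.normalPart_eq hq, mink_add_left]
    module
  map_smul c x := by
    simp only [h.normalPart_eq hq, mink_smul_left]
    module

theorem normalPart_left : normalPart Φ q (along X Φ q) = 0 := by
  rw [h.normalPart_eq hq, h.mink_along_map hq, h.left_left q hq, h.left_right q hq]
  simp

theorem normalPart_right : normalPart Φ q (along Y Φ q) = 0 := by
  rw [h.normalPart_eq hq, h.mink_along_map hq, h.right_right q hq, mink_comm,
    h.left_right q hq]
  simp

/-- The coefficients in the frame of the local extension of a tangent vector are smooth. -/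
theorem exists_extendVec_eq (w : TangentSpace (𝓡 2) q) : ∃ a b : M → ℝ,
    SmoothFnAt a q ∧ SmoothFnAt b q ∧
    (∀ᶠ r in 𝓝 q, extendVec w r = a r • X r + b r • Y r) ∧
    a q = mink (pushVec Φ q w) (along X Φ q) ∧ b q = mink (pushVec Φ q w) (along Y Φ q) := by
  have hW : SmoothFnAt (along (extendVec w) Φ) q :=
    (h.smooth_map q hq).along (smoothVFieldAt_extendVec w)
  refine ⟨fun r => mink (along (extendVec w) Φ r) (along X Φ r),
    fun r => mink (along (extendVec w) Φ r) (along Y Φ r), hW.mink (h.smooth_along_left hq),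
    hW.mink (h.smooth_along_right hq), h.eventually hq fun r hr => h.eq_sum hr _, ?_, ?_⟩ <;>
  simp [along, pushVec, extendVec_self]

end IsOrthonormalFrameOn

omit [IsManifold (𝓡 2) ∞ M] in
theorem mvfderiv_smul_add_smul {F : Type*} [NormedAddCommGroup F] [NormedSpace ℝ F]
    {a b : M → ℝ} {V W : M → F} {p : M} (ha : SmoothFnAt a p) (hb : SmoothFnAt b p)
    (hV : SmoothFnAt V p) (hW : SmoothFnAt W p) (v : TangentSpace (𝓡 2) p) :
    mvfderiv (𝓡 2) (fun q => a q • V q + b q • W q) p v =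
      (a p • mvfderiv (𝓡 2) V p v + b p • mvfderiv (𝓡 2) W p v) +
        (mvfderiv (𝓡 2) a p v • V p + mvfderiv (𝓡 2) b p v • W p) := by
  rw [mvfderiv_fun_add (ha.smul hV).mdiff (hb.smul hW).mdiff,
    mvfderiv_fun_smul ha.mdiff hV.mdiff, mvfderiv_fun_smul hb.mdiff hW.mdiff]
  simp only [add_apply, smul_apply, ContinuousLinearMap.smulRight_apply]
  abel

namespace IsOrthonormalFrameOn

variable {Φ : M → Mink5} {X Y : VField M} {U : Set M} (h : IsOrthonormalFrameOn Φ X Y U)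
  {q : M} (hq : q ∈ U)
include h hq

/-- The derivatives of the coefficients of `extendVec w` multiply `along X Φ` and `along Y Φ`, which
`normalPart` kills. The choice of extension thus leaves no trace, and the result has the shape
required by `sum_orthoBasis`. -/
theorem secondFF_eq (v w : TangentSpace (𝓡 2) q) : secondFF Φ q v w =
    mink (pushVec Φ q w) (along X Φ q) • normalPart Φ q (mvfderiv (𝓡 2) (along X Φ) q v) +
    mink (pushVec Φ q w) (along Y Φ q) • normalPart Φ q (mvfderiv (𝓡 2) (along Y Φ) q v) := by
  obtain ⟨a, b, ha, hb, hab, haq, hbq⟩ := h.exists_extendVec_eq hq w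
  have hW : (fun r => pushVec Φ r (extendVec w r)) =ᶠ[𝓝 q]
      fun r => a r • along X Φ r + b r • along Y Φ r := by
    filter_upwards [hab] with r hr
    rw [hr, pushVec_add, pushVec_smul, pushVec_smul]
    rfl
  have h1 : secondFF Φ q v w =
      normalPart Φ q (mvfderiv (𝓡 2) (fun r => pushVec Φ r (extendVec w r)) q v) := rfl
  have hN := h.isLinearMap_normalPart hq
  rw [h1, mvfderiv_congr hW, mvfderiv_smul_add_smul ha hb (h.smooth_along_left hq)
    (h.smooth_along_right hq), hN.map_add, hN.map_add, hN.map_add, hN.map_smul, hN.map_smul,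
    hN.map_smul, hN.map_smul, h.normalPart_left hq, h.normalPart_right hq, haq, hbq]
  simp

theorem tensionField_eq : tensionField Φ q =
    normalPart Φ q (along X (along X Φ) q) + normalPart Φ q (along Y (along Y Φ) q) := by
  have hN := h.isLinearMap_normalPart hq
  have hl (V : M → Mink5) :
      IsLinearMap ℝ fun v : TangentSpace (𝓡 2) q => normalPart Φ q (mvfderiv (𝓡 2) V q v) :=
    ⟨fun x y => by rw [map_add, hN.map_add], fun c x => by rw [map_smul, hN.map_smul]⟩
  have := (h.isOrthonormalBasisAt hq).sum_orthoBasis (hl (along X Φ)) (hl (along Y Φ))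
  simp only [tensionField, h.secondFF_eq hq]
  exact this

-- Tensoriality in `w`: the derivatives of the coefficients of `extendVec w` enter both terms of
-- `secondCov`, each time multiplied by `hypPart` of `along X V` or `along Y V`, and cancel.
omit hq in
theorem secondCov_eq {V : M → Mink5} (hV : ∀ r ∈ U, SmoothFnAt V r) (hq : q ∈ U)
    (v w : TangentSpace (𝓡 2) q) : secondCov Φ V q v w =
    mink (pushVec Φ q w) (along X Φ q) •
      (hypPart Φ q (mvfderiv (𝓡 2) (fun r => hypPart Φ r (along X V r)) q v) -
        covTilde Φ V q (tangentPart Φ q (mvfderiv (𝓡 2) (along X Φ) q v))) +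
    mink (pushVec Φ q w) (along Y Φ q) •
      (hypPart Φ q (mvfderiv (𝓡 2) (fun r => hypPart Φ r (along Y V r)) q v) -
        covTilde Φ V q (tangentPart Φ q (mvfderiv (𝓡 2) (along Y Φ) q v))) := by
  obtain ⟨a, b, ha, hb, hab, haq, hbq⟩ := h.exists_extendVec_eq hq w
  have hW : (fun r => pushVec Φ r (extendVec w r)) =ᶠ[𝓝 q]
      fun r => a r • along X Φ r + b r • along Y Φ r := by
    filter_upwards [hab] with r hr
    rw [hr, pushVec_add, pushVec_smul, pushVec_smul]
    rfl
  have hC : (fun r => covTilde Φ V r (extendVec w r)) =ᶠ[𝓝 q]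
      fun r => a r • hypPart Φ r (along X V r) + b r • hypPart Φ r (along Y V r) := by
    filter_upwards [hab] with r hr
    rw [hr]
    simp only [covTilde, covHat, hypPart, along, map_add, map_smul, mink_add_left, mink_smul_left]
    module
  have hs (Z : VField M) (hZ : SmoothVFieldAt Z q) :
      SmoothFnAt (fun r => hypPart Φ r (along Z V r)) q := by
    have h1 := (hV q hq).along hZ
    exact h1.add ((h1.mink (h.smooth_map q hq)).smul (h.smooth_map q hq))
  have hpp (x : Mink5) : hypPart Φ q (hypPart Φ q x) = hypPart Φ q x := by
    simp only [hypPart, mink_add_left, mink_smul_left, h.mink_self q hq]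
    module
  have h1 : secondCov Φ V q v w =
      hypPart Φ q (mvfderiv (𝓡 2) (fun r => covTilde Φ V r (extendVec w r)) q v) -
      covTilde Φ V q (tangentPart Φ q
        (mvfderiv (𝓡 2) (fun r => pushVec Φ r (extendVec w r)) q v)) := rfl
  have hP : IsLinearMap ℝ (hypPart Φ q) := by
    constructor <;> intros <;> simp only [hypPart, mink_add_left, mink_smul_left] <;> module
  have hT : IsLinearMap ℝ fun x => covTilde Φ V q (tangentPart Φ q x) := by
    constructor <;> intros <;>
      simp only [h.tangentPart_eq hq, covTilde, covHat, mink_add_left, mink_smul_left, map_add,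
        map_smul] <;> module
  have hTX : covTilde Φ V q (tangentPart Φ q (along X Φ q)) = hypPart Φ q (along X V q) := by
    rw [h.tangentPart_eq hq, h.left_left q hq, h.left_right q hq]
    simp [covTilde, covHat, hypPart, along]
  have hTY : covTilde Φ V q (tangentPart Φ q (along Y Φ q)) = hypPart Φ q (along Y V q) := by
    rw [h.tangentPart_eq hq, h.right_right q hq, mink_comm, h.left_right q hq]
    simp [covTilde, covHat, hypPart, along]
  have hT2 := hT.map_add
  have hT3 := hT.map_smul
  rw [h1, mvfderiv_congr hW, mvfderiv_congr hC,
    mvfderiv_smul_add_smul ha hb (h.smooth_along_left hq) (h.smooth_along_right hq),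
    mvfderiv_smul_add_smul ha hb (hs X (h.smooth_left q hq)) (hs Y (h.smooth_right q hq))]
  simp only [hP.map_add, hP.map_smul, hT2, hT3, hTX, hTY, hpp, haq, hbq]
  module

end IsOrthonormalFrameOn

end Frame

/-! ### Structure equations in an adapted frame -/

section Adapted

variable {M : Type*} [TopologicalSpace M] [ChartedSpace (EuclideanSpace ℝ (Fin 2)) M]

theorem mink_along_of_eventually_const {Z : VField M} {V W : M → Mink5} {q : M} {c : ℝ}
    (hV : SmoothFnAt V q) (hW : SmoothFnAt W q) (hc : ∀ᶠ r in 𝓝 q, mink (V r) (W r) = c) :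
    mink (along Z V q) (W q) = -mink (V q) (along Z W q) := by
  have h1 : along Z (fun r => mink (V r) (W r)) q = 0 := by
    rw [along_congr (W := fun _ => c) hc, along_const]
  rw [along_mink hV hW] at h1
  linarith

theorem along_smul_add_smul {F : Type*} [NormedAddCommGroup F] [NormedSpace ℝ F] {Z : VField M}
    {a b : M → ℝ} {V W : M → F} {p : M} (ha : SmoothFnAt a p) (hb : SmoothFnAt b p)
    (hV : SmoothFnAt V p) (hW : SmoothFnAt W p) :
    along Z (fun q => a q • V q + b q • W q) p = (a p • along Z V p + b p • along Z W p) +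
        (along Z a p • V p + along Z b p • W p) :=
  mvfderiv_smul_add_smul ha hb hV hW _

variable [IsManifold (𝓡 2) ∞ M]

namespace IsOrthonormalFrameOn

variable {Φ : M → Mink5} {X Y : VField M} {U : Set M} (h : IsOrthonormalFrameOn Φ X Y U)
  {q : M} (hq : q ∈ U)
include h hq

theorem mink_along_left_left {Z : VField M} : mink (along Z (along X Φ) q) (along X Φ q) = 0 := by
  have := mink_along_of_eventually_const (Z := Z) (h.smooth_along_left hq)
    (h.smooth_along_left hq) (h.eventually hq h.left_left)
  rw [mink_comm (along X Φ q)] at this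
  linarith

theorem mink_along_right_right {Z : VField M} :
    mink (along Z (along Y Φ) q) (along Y Φ q) = 0 := by
  have := mink_along_of_eventually_const (Z := Z) (h.smooth_along_right hq)
    (h.smooth_along_right hq) (h.eventually hq h.right_right)
  rw [mink_comm (along Y Φ q)] at this
  linarith

theorem mink_along_right_left {Z : VField M} :
    mink (along Z (along Y Φ) q) (along X Φ q) = -mink (along Z (along X Φ) q) (along Y Φ q) := by
  have := mink_along_of_eventually_const (Z := Z) (h.smooth_along_left hq)
    (h.smooth_along_right hq) (h.eventually hq h.left_right)
  rw [this, mink_comm (along X Φ q), neg_neg]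

theorem mink_along_map_of_normal {Z : VField M} {V : M → Mink5} (hV : SmoothFnAt V q)
    (hVΦ : ∀ᶠ r in 𝓝 q, mink (V r) (Φ r) = 0) (hVZ : mink (V q) (along Z Φ q) = 0) :
    mink (along Z V q) (Φ q) = 0 := by
  rw [mink_along_of_eventually_const hV (h.smooth_map q hq) hVΦ, hVZ, neg_zero]

theorem exists_commutator_coeff : ∃ z₁ z₂ : ℝ,
    ∀ (F : Type) [NormedAddCommGroup F] [NormedSpace ℝ F] (V : M → F), SmoothFnAt V q →
      along X (along Y V) q - along Y (along X V) q = z₁ • along X V q + z₂ • along Y V q := by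
  obtain ⟨z, hz⟩ := exists_commutator (h.smooth_left q hq) (h.smooth_right q hq)
  refine ⟨mink (pushVec Φ q z) (along X Φ q), mink (pushVec Φ q z) (along Y Φ q),
    fun F _ _ V hV => ?_⟩
  rw [hz F V hV]
  conv_lhs => rw [h.eq_sum hq z, map_add, map_smul, map_smul]
  rfl

/-- The torsion-freeness of the induced connection, with its coefficients in the frame. -/
theorem commutator (F : Type) [NormedAddCommGroup F] [NormedSpace ℝ F] {V : M → F}
    (hV : SmoothFnAt V q) :
    along X (along Y V) q - along Y (along X V) q =
      -(mink (along X (along X Φ) q) (along Y Φ q) • along X V q +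
        mink (along Y (along X Φ) q) (along Y Φ q) • along Y V q) := by
  obtain ⟨z₁, z₂, hz⟩ := h.exists_commutator_coeff hq
  -- The coefficients `z₁`, `z₂` serve every `V`, so the case `V = Φ`, paired with the frame,
  -- determines them.
  have hΦ := hz Mink5 Φ (h.smooth_map q hq)
  have e1 := congrArg (fun x => mink x (along X Φ q)) hΦ
  have e2 := congrArg (fun x => mink x (along Y Φ q)) hΦ
  simp only [mink_sub_left, mink_add_left, mink_smul_left, h.left_left q hq, h.right_right q hq,
    h.left_right q hq, mink_comm (along Y Φ q) (along X Φ q), h.mink_along_left_left hq,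
    h.mink_along_right_left hq, h.mink_along_right_right hq] at e1 e2
  rw [hz F V hV, show z₁ = -mink (along X (along X Φ) q) (along Y Φ q) by linarith,
    show z₂ = -mink (along Y (along X Φ) q) (along Y Φ q) by linarith]
  module

end IsOrthonormalFrameOn

/-- A frame field `{X, Y}`, a unit normal field `n` and a function `f` on an open set `U`, with `X`
in the direction of the gradient of `f`, with `n` parallel in the normal bundle, with mean
curvature vector field `f n`, and with vanishing tangential part of the bitension field. -/
structure IsAdaptedFrameOn (Φ : M → Mink5) (X Y : VField M) (n : M → Mink5) (f : M → ℝ)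
    (U : Set M) : Prop extends IsOrthonormalFrameOn Φ X Y U where
  smooth_f : ∀ q ∈ U, SmoothFnAt f q
  smooth_n : ∀ q ∈ U, SmoothFnAt n q
  f_pos : ∀ q ∈ U, 0 < f q
  along_left_f : ∀ q ∈ U, along X f q ≠ 0
  along_right_f : ∀ q ∈ U, along Y f q = 0
  n_n : ∀ q ∈ U, mink (n q) (n q) = 1
  n_map : ∀ q ∈ U, mink (n q) (Φ q) = 0
  n_left : ∀ q ∈ U, mink (n q) (along X Φ q) = 0
  n_right : ∀ q ∈ U, mink (n q) (along Y Φ q) = 0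
  tension : ∀ q ∈ U, tensionField Φ q = (2 * f q) • n q
  parallel_left : ∀ q ∈ U, along X n q = mink (along X n q) (along X Φ q) • along X Φ q +
    mink (along X n q) (along Y Φ q) • along Y Φ q
  parallel_right : ∀ q ∈ U, along Y n q = mink (along Y n q) (along X Φ q) • along X Φ q +
    mink (along Y n q) (along Y Φ q) • along Y Φ q
  biconservative : ∀ q ∈ U, tangentPart Φ q (bitensionField Φ q) = 0

/-! ### The shape operator of `n`, and the third derivative of `Φ` along `Y` -/

namespace IsAdaptedFrameOn

variable {Φ : M → Mink5} {X Y : VField M} {n : M → Mink5} {f : M → ℝ} {U : Set M}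
  (h : IsAdaptedFrameOn Φ X Y n f U) {q : M} (hq : q ∈ U)
include h

theorem smooth_two_f_n (hq : q ∈ U) : SmoothFnAt (fun r => (2 * f r) • n r) q :=
  SmoothFnAt.smul (SmoothFnAt.mul (a := fun _ => (2 : ℝ)) contMDiffAt_const (h.smooth_f q hq))
    (h.smooth_n q hq)

theorem smooth_tensionField (hq : q ∈ U) : SmoothFnAt (tensionField Φ) q :=
  (h.smooth_two_f_n hq).congr_of_eventuallyEq (h.eventually hq h.tension)

include hq

theorem along_tensionField (Z : VField M) : along Z (tensionField Φ) q =
    (2 * f q) • along Z n q + (2 * along Z f q) • n q := by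
  rw [along_congr (h.eventually hq h.tension : tensionField Φ =ᶠ[𝓝 q] fun r => (2 * f r) • n r),
    along_smul (SmoothFnAt.mul (a := fun _ => (2 : ℝ)) contMDiffAt_const (h.smooth_f q hq))
      (h.smooth_n q hq), along_mul (a := fun _ => (2 : ℝ)) contMDiffAt_const (h.smooth_f q hq),
    along_const]
  simp

theorem mink_along_tensionField_map {Z : VField M}
    (hZ : mink (n q) (along Z Φ q) = 0) : mink (along Z (tensionField Φ) q) (Φ q) = 0 := by
  have := h.mink_along_map_of_normal hq (Z := Z) (h.smooth_n q hq) (h.eventually hq h.n_map) hZ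
  rw [h.along_tensionField hq, mink_add_left, mink_smul_left, mink_smul_left, this,
    h.n_map q hq]
  ring

/-- The tangential part of the bitension field in the frame. -/
theorem sum_mink_along_along_tensionField {c : Mink5} (hc : c = along X Φ q ∨ c = along Y Φ q) :
    mink (along X (along X (tensionField Φ)) q) c + mink (along Y (along Y (tensionField Φ)) q) c -
      mink (along X (along X Φ) q) (along Y Φ q) * mink (along Y (tensionField Φ) q) c +
      mink (along Y (along X Φ) q) (along Y Φ q) * mink (along X (tensionField Φ) q) c = 0 := by
  have hτ : ∀ r ∈ U, SmoothFnAt (tensionField Φ) r := fun r hr => h.smooth_tensionField hr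
  have hcΦ : mink (Φ q) c = 0 := by
    rcases hc with rfl | rfl <;> rw [mink_comm] <;> exact h.mink_along_map hq
  have hnc : mink (n q) c = 0 := by
    rcases hc with rfl | rfl
    exacts [h.n_left q hq, h.n_right q hq]
  have h0 : mink (bitensionField Φ q) c = 0 := by
    have h1 := congrArg (pushVec Φ q) (h.biconservative q hq)
    rw [h.pushVec_tangentPart hq] at h1
    have h2 : mink (bitensionField Φ q) c =
        mink (pushVec Φ q (tangentPart Φ q (bitensionField Φ q))) c := by
      rw [h.pushVec_tangentPart hq, mink_add_left, mink_smul_left, mink_smul_left]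
      rcases hc with rfl | rfl
      · rw [h.left_left q hq, mink_comm (along Y Φ q), h.left_right q hq]; ring
      · rw [h.right_right q hq, h.left_right q hq]; ring
    rw [h2, h.biconservative q hq, pushVec, map_zero, mink_zero_left]
  -- The derivatives of the tension field are orthogonal to `Φ` throughout `U`, so the inner
  -- projection can be dropped before differentiating again.
  have hX : (fun r => hypPart Φ r (along X (tensionField Φ) r)) =ᶠ[𝓝 q]
      along X (tensionField Φ) := h.eventually hq fun r hr => by
    simp [hypPart, h.mink_along_tensionField_map hr (h.n_left r hr)]
  have hY : (fun r => hypPart Φ r (along Y (tensionField Φ) r)) =ᶠ[𝓝 q]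
      along Y (tensionField Φ) := h.eventually hq fun r hr => by
    simp [hypPart, h.mink_along_tensionField_map hr (h.n_right r hr)]
  have hl (V W : M → Mink5) : IsLinearMap ℝ fun v : TangentSpace (𝓡 2) q =>
      hypPart Φ q (mvfderiv (𝓡 2) V q v) -
        covTilde Φ (tensionField Φ) q (tangentPart Φ q (mvfderiv (𝓡 2) W q v)) := by
    constructor <;> intros <;>
      simp only [h.tangentPart_eq hq, hypPart, covTilde, covHat, mink_add_left, mink_smul_left,
        map_add, map_smul] <;> module
  have htr := (h.isOrthonormalBasisAt hq).sum_orthoBasis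
    (hl (along X (tensionField Φ)) (along X Φ)) (hl (along Y (tensionField Φ)) (along Y Φ))
  have hsum : roughLaplacian Φ (tensionField Φ) q =
      -((hypPart Φ q (along X (along X (tensionField Φ)) q) -
        covTilde Φ (tensionField Φ) q (tangentPart Φ q (along X (along X Φ) q))) +
      (hypPart Φ q (along Y (along Y (tensionField Φ)) q) -
        covTilde Φ (tensionField Φ) q (tangentPart Φ q (along Y (along Y Φ) q)))) := by
    simp only [roughLaplacian, h.secondCov_eq hτ hq, mvfderiv_congr hX, mvfderiv_congr hY]
    exact congrArg Neg.neg htr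
  -- In constant curvature `-1`, `R(v, τ)v = ⟨v, v⟩ τ` for normal `τ`: the curvature term has no
  -- tangential part.
  have hR (v : TangentSpace (𝓡 2) q) :
      mink (hypCurvature (pushVec Φ q v) (tensionField Φ q) (pushVec Φ q v)) c = 0 := by
    have : mink (n q) (pushVec Φ q v) = 0 := by
      rw [h.eq_sum hq v, pushVec_add, pushVec_smul, pushVec_smul, mink_add_right, mink_smul_right,
        mink_smul_right]
      have e1 := h.n_left q hq
      have e2 := h.n_right q hq
      simp only [along] at e1 e2
      simp only [pushVec, e1, e2, mul_zero, add_zero]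
    simp [hypCurvature, h.tension q hq, mink_smul_left, this, hnc]
  rw [bitensionField, Fin.sum_univ_two, mink_sub_left, mink_add_left, hR, hR, hsum, neg_neg] at h0
  have hcov (x : Mink5) : mink (covTilde Φ (tensionField Φ) q (tangentPart Φ q x)) c =
      mink x (along X Φ q) * mink (along X (tensionField Φ) q) c +
      mink x (along Y Φ q) * mink (along Y (tensionField Φ) q) c := by
    simp only [h.tangentPart_eq hq, covTilde, covHat, mink_add_left, mink_smul_left, map_add,
      map_smul, hcΦ, along]
    ring
  -- Here `∇_X X = ω₁ Y` and `∇_Y Y = -ω₂ X`, with `ω₁`, `ω₂` the connection coefficients; hence the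
  -- opposite signs of the last two terms.
  simp only [mink_add_left, mink_sub_left, hcov, hypPart, mink_smul_left, hcΦ,
    h.mink_along_left_left hq, h.mink_along_right_left hq, h.mink_along_right_right hq] at h0
  linarith

omit hq

theorem mink_along_n {V : M → Mink5} {Z : VField M} (hq : q ∈ U) (hV : SmoothFnAt V q)
    (hn : ∀ r ∈ U, mink (n r) (V r) = 0) :
    mink (along Z n q) (V q) = -mink (along Z V q) (n q) := by
  rw [mink_along_of_eventually_const (h.smooth_n q hq) hV (h.eventually hq hn), mink_comm]

/-- The symmetry of the shape operator. -/
theorem shape_symm (hq : q ∈ U) :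
    mink (along Y n q) (along X Φ q) = mink (along X n q) (along Y Φ q) := by
  have hc := h.commutator hq Mink5 (h.smooth_map q hq)
  have := congrArg (fun x => mink x (n q)) hc
  simp only [mink_sub_left, mink_neg_left, mink_add_left, mink_smul_left] at this
  simp only [mink_comm _ (n q), h.n_left q hq, h.n_right q hq] at this
  rw [h.mink_along_n hq (h.smooth_along_left hq) h.n_left,
    h.mink_along_n hq (h.smooth_along_right hq) h.n_right, mink_comm _ (n q), mink_comm _ (n q)]
  linarith

/-- The trace of the shape operator. -/
theorem shape_trace (hq : q ∈ U) :
    mink (along X n q) (along X Φ q) + mink (along Y n q) (along Y Φ q) = -(2 * f q) := by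
  have ht := congrArg (fun x => mink x (n q)) (h.tension q hq)
  simp only [h.tensionField_eq hq, h.normalPart_eq hq, mink_sub_left, mink_add_left,
    mink_smul_left, h.n_n q hq] at ht
  simp only [mink_comm _ (n q), h.n_left q hq, h.n_right q hq, h.n_map q hq] at ht
  rw [h.mink_along_n hq (h.smooth_along_left hq) h.n_left,
    h.mink_along_n hq (h.smooth_along_right hq) h.n_right, mink_comm _ (n q), mink_comm _ (n q)]
  linarith

/-- With `S = (A B; B C)` in the frame, `b1`, `b2` are the components of `2f div S + 4 S(grad f) =
0`, `c1`, `c2` those of the Codazzi equation, and `t1`, `t2` the derivatives of `A + C = -2f`.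
Eliminating `div S` leaves `X(f) B = 0` and `X(f) (A - f) = 0`, where `X(f) ≠ 0`. -/
theorem shape_off_diagonal_and_left (hq : q ∈ U) :
    mink (along X n q) (along Y Φ q) = 0 ∧ mink (along X n q) (along X Φ q) = f q := by
  set A : M → ℝ := fun r => mink (along X n r) (along X Φ r) with hA
  set B : M → ℝ := fun r => mink (along X n r) (along Y Φ r) with hB
  set C : M → ℝ := fun r => mink (along Y n r) (along Y Φ r) with hC
  have sX := h.smooth_along_left hq
  have sY := h.smooth_along_right hq
  have sn1 := (h.smooth_n q hq).along (h.smooth_left q hq)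
  have sn2 := (h.smooth_n q hq).along (h.smooth_right q hq)
  have sA : SmoothFnAt A q := sn1.mink sX
  have sB : SmoothFnAt B q := sn1.mink sY
  have sC : SmoothFnAt C q := sn2.mink sY
  have hn1 : along X n =ᶠ[𝓝 q] fun r => A r • along X Φ r + B r • along Y Φ r :=
    h.eventually hq h.parallel_left
  have hn2 : along Y n =ᶠ[𝓝 q] fun r => B r • along X Φ r + C r • along Y Φ r :=
    h.eventually hq fun r hr => by
      simp only [hB, hC]
      rw [← h.shape_symm hr]
      exact h.parallel_right r hr
  have hsum (Z : VField M) : along Z A q + along Z C q = -(2 * along Z f q) := by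
    have : (fun r => A r + C r) =ᶠ[𝓝 q] fun r => (-2) * f r :=
      h.eventually hq fun r hr => by
        linear_combination h.shape_trace hr
    rw [← along_add sA sC, along_congr this,
      along_mul (a := fun _ => (-2 : ℝ)) contMDiffAt_const (h.smooth_f q hq), along_const]
    ring
  have d1 (Z : VField M) : along Z (along X n) q = _ :=
    (along_congr hn1).trans (along_smul_add_smul sA sB sX sY)
  have d2 (Z : VField M) : along Z (along Y n) q = _ :=
    (along_congr hn2).trans (along_smul_add_smul sB sC sX sY)
  -- The tension field is `2f n`; the term with the second derivative of `f` is a multiple of `n`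
  -- and drops out against the tangent vector `c`.
  have hτ (W : VField M) (sW : SmoothVFieldAt W q) (c : Mink5) (hc : mink (n q) c = 0) :
      mink (along W (along W (tensionField Φ)) q) c =
      2 * f q * mink (along W (along W n) q) c + 4 * along W f q * mink (along W n q) c := by
    have e : along W (tensionField Φ) =ᶠ[𝓝 q] fun r => (2 * f r) • along W n r +
        (2 * along W f r) • n r := h.eventually hq fun r hr => h.along_tensionField hr W
    have s2 : SmoothFnAt (fun _ : M => (2 : ℝ)) q := contMDiffAt_const
    have sf := h.smooth_f q hq
    have sf1 := sf.along sW
    rw [along_congr e, along_smul_add_smul (s2.mul sf) (s2.mul sf1) ((h.smooth_n q hq).along sW)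
      (h.smooth_n q hq), along_mul s2 sf, along_const]
    simp only [mink_add_left, mink_smul_left, hc]
    ring
  have nX := h.n_left q hq
  have nY := h.n_right q hq
  have b1 := h.sum_mink_along_along_tensionField hq (Or.inl rfl)
  have b2 := h.sum_mink_along_along_tensionField hq (Or.inr rfl)
  rw [hτ X (h.smooth_left q hq) _ nX, hτ Y (h.smooth_right q hq) _ nX, h.along_tensionField hq,
    h.along_tensionField hq, d1 X, d2 Y, h.along_right_f q hq] at b1
  rw [hτ X (h.smooth_left q hq) _ nY, hτ Y (h.smooth_right q hq) _ nY, h.along_tensionField hq,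
    h.along_tensionField hq, d1 X, d2 Y, h.along_right_f q hq] at b2
  have hcomm := h.commutator hq Mink5 (h.smooth_n q hq)
  rw [d2 X, d1 Y] at hcomm
  have c1 := congrArg (fun x => mink x (along X Φ q)) hcomm
  have c2 := congrArg (fun x => mink x (along Y Φ q)) hcomm
  have fA : mink (along X n q) (along X Φ q) = A q := rfl
  have fB : mink (along X n q) (along Y Φ q) = B q := rfl
  have fB' : mink (along Y n q) (along X Φ q) = B q := h.shape_symm hq
  have fC : mink (along Y n q) (along Y Φ q) = C q := rfl
  simp only [mink_sub_left, mink_neg_left, mink_add_left, mink_smul_left, h.left_left q hq,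
    h.right_right q hq, h.left_right q hq, mink_comm (along Y Φ q) (along X Φ q),
    h.mink_along_left_left hq, h.mink_along_right_left hq, h.mink_along_right_right hq,
    fA, fB, fB', fC, nX, nY] at b1 b2 c1 c2
  have t1 := hsum X
  have t2 := hsum Y
  rw [h.along_right_f q hq] at t2
  have hf1 := h.along_left_f q hq
  constructor
  · have : along X f q * B q = 0 := by
      linear_combination (1 / 4) * b2 - (f q / 2) * c1 - (f q / 2) * t2
    exact (mul_eq_zero.1 this).resolve_left hf1
  · have : along X f q * (A q - f q) = 0 := by
      linear_combination (1 / 4) * b1 + (f q / 2) * c2 - (f q / 2) * t1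
    linarith [(mul_eq_zero.1 this).resolve_left hf1]

theorem along_left_n (hq : q ∈ U) : along X n q = f q • along X Φ q := by
  obtain ⟨h1, h2⟩ := h.shape_off_diagonal_and_left hq
  rw [h.parallel_left q hq, h1, h2]
  simp

theorem along_right_n (hq : q ∈ U) : along Y n q = (-3 * f q) • along Y Φ q := by
  obtain ⟨h1, h2⟩ := h.shape_off_diagonal_and_left hq
  have h3 := h.shape_trace hq
  rw [h.parallel_right q hq, h.shape_symm hq, h1,
    show mink (along Y n q) (along Y Φ q) = -3 * f q by linarith]
  simp

/-- The commutator identity for `n` is an equation of vectors in `ℝ⁵₁`, so it controls normal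
components as well as the connection coefficient. In particular the second fundamental form vanishes
on `(X, Y)`. -/
theorem along_left_right_and_coeff (hq : q ∈ U) : along X (along Y Φ) q = 0 ∧
    mink (along Y (along X Φ) q) (along Y Φ q) = (-3 / 4) * (along X f q * (f q)⁻¹) := by
  have hf := h.smooth_f q hq
  have e1 : along X n =ᶠ[𝓝 q] fun r => f r • along X Φ r :=
    h.eventually hq fun r hr => h.along_left_n hr
  have e2 : along Y n =ᶠ[𝓝 q] fun r => (-3 * f r) • along Y Φ r :=
    h.eventually hq fun r hr => h.along_right_n hr
  have sc : SmoothFnAt (fun _ : M => (-3 : ℝ)) q := contMDiffAt_const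
  have hcn := h.commutator hq Mink5 (h.smooth_n q hq)
  have hcΦ := h.commutator hq Mink5 (h.smooth_map q hq)
  set ω₁ := mink (along X (along X Φ) q) (along Y Φ q)
  set ω₂ := mink (along Y (along X Φ) q) (along Y Φ q)
  rw [along_congr e1, along_congr e2, along_smul hf (h.smooth_along_left hq),
    along_smul (sc.mul hf) (h.smooth_along_right hq), along_mul sc hf, along_const,
    h.along_right_f q hq, h.along_left_n hq, h.along_right_n hq] at hcn
  have key : (4 * f q) • along X (along Y Φ) q =
      (-(3 * along X f q + 4 * f q * ω₂)) • along Y Φ q := by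
    -- Adding `f` times the commutator identity for `Φ` removes the term in `along Y (along X Φ)`,
    -- together with the coefficient `ω₁`.
    have h1 := congrArg (fun x => f q • x) hcΦ
    linear_combination (norm := module) h1 - hcn
  -- The left side of `key` is orthogonal to the unit vector `along Y Φ`, so the coefficient on the
  -- right must vanish.
  have key2 := congrArg (fun x => mink x (along Y Φ q)) key
  simp only [mink_smul_left, h.mink_along_right_right hq, h.right_right q hq] at key2
  have hfp := h.f_pos q hq
  constructor
  · rw [show -(3 * along X f q + 4 * f q * ω₂) = 0 by linarith, zero_smul] at key
    exact (smul_eq_zero.1 key).resolve_left (by positivity)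
  · field_simp
    linarith

/-- The second derivative of `Φ` along `Y` has a derivative along `Y` proportional to `Φ_* Y`. -/
theorem along_right_accel (hq : q ∈ U) : along Y (along Y (along Y Φ)) q =
    (-mink (along Y (along Y Φ) q) (along Y (along Y Φ) q)) • along Y Φ q := by
  set w : M → ℝ := fun r => (-3 / 4) * (along X f r * (f r)⁻¹) with hw
  have hf := h.smooth_f q hq
  have hf1 := hf.along (h.smooth_left q hq)
  have hfi := hf.inv (h.f_pos q hq).ne'
  have sX := h.smooth_along_left hq
  have sY := h.smooth_along_right hq
  have sc (c : ℝ) : SmoothFnAt (fun _ : M => c) q := contMDiffAt_const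
  have sw : SmoothFnAt w q := (sc _).mul (hf1.mul hfi)
  have hXY : ∀ r ∈ U, along X (along Y Φ) r = 0 := fun r hr =>
    (h.along_left_right_and_coeff hr).1
  have hw₂ : ∀ r ∈ U, mink (along Y (along X Φ) r) (along Y Φ r) = w r := fun r hr =>
    (h.along_left_right_and_coeff hr).2
  have hw₁ : ∀ r ∈ U, mink (along X (along X Φ) r) (along Y Φ r) = 0 := fun r hr => by
    have := h.mink_along_right_left hr (Z := X)
    rw [hXY r hr, mink_zero_left] at this
    linarith
  have hcomm (r : M) (hr : r ∈ U) (F : Type) [NormedAddCommGroup F] [NormedSpace ℝ F]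
      (V : M → F) (hV : SmoothFnAt V r) :
      along X (along Y V) r - along Y (along X V) r = -(w r • along Y V r) := by
    rw [h.commutator hr F hV, hw₁ r hr, hw₂ r hr, zero_smul, zero_add]
  have hYX : ∀ r ∈ U, along Y (along X Φ) r = w r • along Y Φ r := fun r hr => by
    have := hcomm r hr Mink5 Φ (h.smooth_map r hr)
    rw [hXY r hr, zero_sub] at this
    exact neg_injective this
  -- Since `w` is built from `f` and `X(f)`, it suffices that `Y(f) = 0` and `Y(X(f)) = X(Y(f)) + w
  -- Y(f) = 0`.
  have hYw : along Y w q = 0 := by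
    have h1 := hcomm q hq ℝ f hf
    have h2 : along X (along Y f) q = 0 := by
      rw [along_congr (W := fun _ => (0 : ℝ)) (h.eventually hq h.along_right_f), along_const]
    rw [h2, h.along_right_f q hq, smul_zero, zero_sub, neg_zero, neg_eq_zero] at h1
    have h3 : along Y (fun r => (f r)⁻¹) q = 0 := by
      have h4 : along Y (fun r => f r * (f r)⁻¹) q = 0 := by
        rw [along_congr (W := fun _ => (1 : ℝ))
          (h.eventually hq fun r hr => mul_inv_cancel₀ (h.f_pos r hr).ne'), along_const]
      rw [along_mul hf hfi, h.along_right_f q hq, zero_mul, add_zero] at h4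
      exact (mul_eq_zero.1 h4).resolve_left (h.f_pos q hq).ne'
    rw [hw, along_mul (sc _) (hf1.mul hfi), along_mul hf1 hfi, along_const, h1, h3]
    ring
  -- This is the equation `τ = 2f n` solved for `∇̂_Y Y`. The term `2Φ` collects the contributions
  -- of the hyperboloid, as `⟨∇̂_X X, Φ⟩ = ⟨∇̂_Y Y, Φ⟩ = -1`.
  have hten : ∀ r ∈ U, along Y (along Y Φ) r =
      (2 : ℝ) • Φ r - w r • along X Φ r + ((2 * f r) • n r - along X (along X Φ) r) := by
    intro r hr
    have h1 := h.tensionField_eq hr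
    have hΦX : mink (along X (along X Φ) r) (Φ r) = -1 := by
      rw [mink_along_of_eventually_const (c := 0) (h.smooth_along_left hr) (h.smooth_map r hr)
        (h.eventually hr fun s hs => h.mink_along_map hs), h.left_left r hr]
    have hΦY : mink (along Y (along Y Φ) r) (Φ r) = -1 := by
      rw [mink_along_of_eventually_const (c := 0) (h.smooth_along_right hr) (h.smooth_map r hr)
        (h.eventually hr fun s hs => h.mink_along_map hs), h.right_right r hr]
    rw [h.tension r hr, h.normalPart_eq hr, h.normalPart_eq hr, hΦX, hΦY,
      h.mink_along_left_left hr, h.mink_along_right_right hr, h.mink_along_right_left hr,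
      hw₁ r hr, hw₂ r hr] at h1
    rw [h1]
    module
  obtain ⟨μ, hμ⟩ : ∃ μ : ℝ, along Y (along Y (along Y Φ)) q = μ • along Y Φ q := by
    have hc := hcomm q hq Mink5 (along X Φ) sX
    have e : along Y (along X Φ) =ᶠ[𝓝 q] fun r => w r • along Y Φ r := h.eventually hq hYX
    rw [along_congr e, along_smul sw sY, hXY q hq, hYX q hq, smul_zero, zero_add] at hc
    have e2 : along Y (along Y Φ) =ᶠ[𝓝 q] fun r =>
        (2 : ℝ) • Φ r - w r • along X Φ r + ((2 * f r) • n r - along X (along X Φ) r) :=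
      h.eventually hq hten
    have s1 : SmoothFnAt (fun r => (2 : ℝ) • Φ r) q := (sc 2).smul (h.smooth_map q hq)
    have s2 := sw.smul sX
    have s3 := h.smooth_two_f_n hq
    have s4 := sX.along (h.smooth_left q hq)
    -- The contributions are `2` from `2Φ`, `-w²` from `-w X`, `-6f²` from `2f n`, and `-(X(w) +
    -- w²)` from `-∇̂_X X`. The last one comes from the commutator applied to `along X Φ`.
    refine ⟨2 - w q ^ 2 - 6 * f q ^ 2 - along X w q - w q ^ 2, ?_⟩
    rw [along_congr e2, along_add (s1.sub s2) (s3.sub s4), along_sub s1 s2, along_sub s3 s4,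
      along_smul (sc 2) (h.smooth_map q hq), along_const, along_smul sw sX, hYw,
      along_smul ((sc 2).mul hf) (h.smooth_n q hq), along_mul (sc 2) hf, along_const,
      h.along_right_f q hq, hYX q hq, h.along_right_n hq]
    linear_combination (norm := module) hc
  -- The explicit factor is not needed: differentiating `⟨W, Y⟩ = 0` along `Y` gives `μ = -⟨W, W⟩`.
  have hW := mink_along_of_eventually_const (Z := Y) (c := 0) (sY.along (h.smooth_right q hq)) sY
    (h.eventually hq fun r hr => h.mink_along_right_right hr)
  rw [hμ, mink_smul_left, h.right_right q hq, mul_one] at hW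
  rw [hμ, hW]

end IsAdaptedFrameOn

end Adapted

/-! ### Existence of adapted frames -/

section Existence

variable {M : Type*} [TopologicalSpace M] [ChartedSpace (EuclideanSpace ℝ (Fin 2)) M]
  [IsManifold (𝓡 2) ∞ M] {Φ : M → Mink5}

/-- Gram–Schmidt on a local extension of `v`, against the given unit field `Y`. The frame must not
presuppose that the mean curvature is smooth, which is why it is not built from `frameE1`. -/
theorem IsOrthonormalFrameOn.exists_near {Y : VField M} (hΦ : ∀ q, SmoothFnAt Φ q)
    (hY : ∀ q, SmoothVFieldAt Y q) (hmem : ∀ q, mink (Φ q) (Φ q) = -1)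
    (hunit : ∀ q, inducedMetric Φ q (Y q) (Y q) = 1) {p : M} (v : TangentSpace (𝓡 2) p)
    (hv : 0 < inducedMetric Φ p v v) (hvY : inducedMetric Φ p v (Y p) = 0) :
    ∃ (X : VField M) (U : Set M), p ∈ U ∧ IsOrthonormalFrameOn Φ X Y U := by
  obtain ⟨s, hs, hsv⟩ : ∃ s ∈ 𝓝 p, ContMDiffOn (𝓡 2) (𝓡 2).tangent ∞
      (fun q => (⟨q, extendVec v q⟩ : TangentBundle (𝓡 2) M)) s :=
    FiberBundle.exists_contMDiffOn_extend (𝓡 2) (EuclideanSpace ℝ (Fin 2)) v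
  have hV : ∀ q ∈ interior s, SmoothVFieldAt (extendVec v) q := fun q hq =>
    hsv.contMDiffAt (mem_interior_iff_mem_nhds.1 hq)
  set c : M → ℝ := fun q => mink (along (extendVec v) Φ q) (along Y Φ q) with hc_def
  set X' : VField M := fun q => extendVec v q + (-c q) • Y q with hX'_def
  have hc : ∀ q ∈ interior s, SmoothFnAt c q := fun q hq =>
    ((hΦ q).along (hV q hq)).mink ((hΦ q).along (hY q))
  have hX' : ∀ q ∈ interior s, SmoothVFieldAt X' q := fun q hq =>
    (hV q hq).add_section ((hc q hq).neg.smul_section (hY q))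
  set m : M → ℝ := fun q => mink (along X' Φ q) (along X' Φ q) with hm_def
  have hm : ∀ q ∈ interior s, SmoothFnAt m q := fun q hq =>
    ((hΦ q).along (hX' q hq)).mink ((hΦ q).along (hX' q hq))
  have hcp : c p = 0 := by
    simp only [hc_def, along, extendVec_self]
    exact hvY
  have hmp : 0 < m p := by
    simp only [hm_def, hX'_def, along, extendVec_self, hcp, neg_zero, zero_smul, add_zero]
    exact hv
  have hXY : ∀ q, mink (along X' Φ q) (along Y Φ q) = 0 := fun q => by
    have h1 : along X' Φ q = along (extendVec v) Φ q + (-c q) • along Y Φ q := by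
      simp only [along, hX'_def, map_add, map_smul]
    have h2 : mink (along Y Φ q) (along Y Φ q) = 1 := hunit q
    rw [h1, mink_add_left, mink_smul_left, h2]
    simp [hc_def]
  set X : VField M := fun q => (√(m q))⁻¹ • X' q with hX_def
  have hXX' : ∀ q, along X Φ q = (√(m q))⁻¹ • along X' Φ q := fun q => by
    simp only [along, hX_def, map_smul]
  refine ⟨X, interior s ∩ m ⁻¹' Set.Ioi 0, ⟨mem_interior_iff_mem_nhds.2 hs, hmp⟩, ?_, ?_, ?_, ?_,
    ?_, ?_, ?_, ?_⟩
  · exact ContinuousOn.isOpen_inter_preimage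
      (fun q hq => (hm q hq).continuousAt.continuousWithinAt) isOpen_interior isOpen_Ioi
  · exact fun q _ => hΦ q
  · rintro q ⟨hq, hmq⟩
    have hmq' : 0 < m q := hmq
    exact (((hm q hq).sqrt hmq'.ne').inv (Real.sqrt_pos.2 hmq').ne').smul_section (hX' q hq)
  · exact fun q _ => hY q
  · exact fun q _ => hmem q
  · rintro q ⟨hq, hmq⟩
    have hmq' : 0 < m q := hmq
    have h1 : √(m q) * √(m q) = m q := Real.mul_self_sqrt hmq'.le
    have h2 : √(m q) ≠ 0 := (Real.sqrt_pos.2 hmq').ne'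
    rw [hXX', mink_smul_left, mink_smul_right]
    change (√(m q))⁻¹ * ((√(m q))⁻¹ * m q) = 1
    field_simp
    linarith
  · intro q _
    rw [hXX', mink_smul_left, hXY, mul_zero]
  · exact fun q _ => hunit q

namespace IsPNMCBiconservative

variable (hΦ : IsPNMCBiconservative Φ)
include hΦ

theorem smoothFnAt (q : M) : SmoothFnAt Φ q := hΦ.smooth q

theorem mink_map_self (q : M) : mink (Φ q) (Φ q) = -1 := (hΦ.mem_hyperbolicSpace q).1

theorem inducedMetric_pos {q : M} {v : TangentSpace (𝓡 2) q} (hv : v ≠ 0) :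
    0 < inducedMetric Φ q v v := by
  refine mink_self_pos_of_orthogonal (hΦ.mink_map_self q) ?_ fun h => hv ?_
  · have := mink_along_of_eventually_const (Z := extendVec v) (hΦ.smoothFnAt q) (hΦ.smoothFnAt q)
      (Eventually.of_forall hΦ.mink_map_self)
    rw [mink_comm (Φ q)] at this
    simp only [along, extendVec_self] at this
    simp only [pushVec]
    linarith
  · exact hΦ.immersion q (h.trans (map_zero (mvfderiv (𝓡 2) Φ q)).symm)

variable {E₂ : VField M} (hE₂ : IsFrameE2 Φ E₂)
include hE₂

theorem isOrthonormalBasisAt (q : M) : IsOrthonormalBasisAt Φ q ![frameE1 Φ q, E₂ q] := by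
  have hpos := hΦ.inducedMetric_pos (hΦ.grad_ne_zero q)
  have h1 : inducedMetric Φ q (frameE1 Φ q) (frameE1 Φ q) = 1 := by
    have h2 := Real.mul_self_sqrt hpos.le
    have h3 := (Real.sqrt_pos.2 hpos).ne'
    rw [frameE1, inducedMetric_smul_left, inducedMetric_smul_right]
    field_simp
    linarith
  intro i j
  fin_cases i <;> fin_cases j
  · simpa using h1
  · simpa using hE₂.orthogonal q
  · simpa using (inducedMetric_comm _ _).trans (hE₂.orthogonal q)
  · simpa using hE₂.unit q

theorem mvfderiv_meanCurvature_frameE2 (q : M) :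
    mvfderiv (𝓡 2) (meanCurvature Φ) q (E₂ q) = 0 := by
  have hpos := hΦ.inducedMetric_pos (hΦ.grad_ne_zero q)
  have h1 := hE₂.orthogonal q
  rw [frameE1, inducedMetric_smul_left,
    inducedMetric_gradM (hΦ.isOrthonormalBasisAt hE₂ q) _ (E₂ q)] at h1
  exact (mul_eq_zero.1 h1).resolve_left (inv_ne_zero (Real.sqrt_pos.2 hpos).ne')

/-- The frame comes first; smoothness of the tension field is then read from its frame formula, that
of `f = |H|` from `⟨H, H⟩ > 0`, and that of `n` from both. Both `X` and grad f are orthogonal to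
`E₂`, so `X = ±E₁`, and the sign plays no role. -/
theorem exists_adaptedFrame (p : M) : ∃ (X : VField M) (U : Set M), p ∈ U ∧
    IsAdaptedFrameOn Φ X E₂ (normalizedMeanCurvature Φ) (meanCurvature Φ) U := by
  have hgrad (q : M) (v : TangentSpace (𝓡 2) q) :=
    inducedMetric_gradM (hΦ.isOrthonormalBasisAt hE₂ q) (meanCurvature Φ) v
  obtain ⟨X, U, hpU, h⟩ := IsOrthonormalFrameOn.exists_near hΦ.smoothFnAt
    (fun q => hE₂.smooth q) hΦ.mink_map_self hE₂.unit (gradM Φ (meanCurvature Φ) p)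
    (hΦ.inducedMetric_pos (hΦ.grad_ne_zero p))
    ((hgrad p _).trans (hΦ.mvfderiv_meanCurvature_frameE2 hE₂ p))
  have hτ : ∀ q ∈ U, SmoothFnAt (tensionField Φ) q := fun q hq => by
    have sN (V : M → Mink5) (hV : SmoothFnAt V q) :
        SmoothFnAt (fun r => V r + mink (V r) (Φ r) • Φ r -
        (mink (V r) (along X Φ r) • along X Φ r +
          mink (V r) (along E₂ Φ r) • along E₂ Φ r)) q := by
      have s1 := h.smooth_along_left hq
      have s2 := h.smooth_along_right hq
      have s0 := hΦ.smoothFnAt q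
      exact (hV.add ((hV.mink s0).smul s0)).sub (((hV.mink s1).smul s1).add ((hV.mink s2).smul s2))
    refine ContMDiffAt.congr_of_eventuallyEq
      ((sN _ ((h.smooth_along_left hq).along (h.smooth_left q hq))).add
        (sN _ ((h.smooth_along_right hq).along (h.smooth_right q hq))))
      (h.eventually hq fun r hr => ?_)
    rw [h.tensionField_eq hr, h.normalPart_eq hr, h.normalPart_eq hr]
  have hHH : ∀ q, 0 < mink (meanCurvatureVector Φ q) (meanCurvatureVector Φ q) := fun q =>
    Real.sqrt_pos.1 (hΦ.meanCurvature_pos q)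
  have sH : ∀ q ∈ U, SmoothFnAt (meanCurvatureVector Φ) q := fun q hq =>
    SmoothFnAt.smul (a := fun _ => (1 / 2 : ℝ)) contMDiffAt_const (hτ q hq)
  have sf : ∀ q ∈ U, SmoothFnAt (meanCurvature Φ) q := fun q hq =>
    ((sH q hq).mink (sH q hq)).sqrt (hHH q).ne'
  have sn : ∀ q ∈ U, SmoothFnAt (normalizedMeanCurvature Φ) q := fun q hq =>
    ((sf q hq).inv (hΦ.meanCurvature_pos q).ne').smul (sH q hq)
  have hΦZ (q : M) (hq : q ∈ U) (Z : VField M) := h.mink_along_map hq (Z := Z)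
  have hN : ∀ q ∈ U, ∀ x, mink (normalPart Φ q x) (Φ q) = 0 ∧
      mink (normalPart Φ q x) (along X Φ q) = 0 ∧
      mink (normalPart Φ q x) (along E₂ Φ q) = 0 := fun q hq x => by
    have e1 := h.left_left q hq
    have e2 := h.left_right q hq
    have e3 := h.right_right q hq
    have e4 := h.mink_self q hq
    simp only [h.normalPart_eq hq, mink_sub_left, mink_add_left, mink_smul_left, e1, e2, e3, e4,
      mink_comm (along E₂ Φ q) (along X Φ q), hΦZ q hq, mink_comm (Φ q) (along _ Φ q)]
    refine ⟨?_, ?_, ?_⟩ <;> ring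
  have hn : ∀ q ∈ U, mink (normalizedMeanCurvature Φ q) (Φ q) = 0 ∧
      mink (normalizedMeanCurvature Φ q) (along X Φ q) = 0 ∧
      mink (normalizedMeanCurvature Φ q) (along E₂ Φ q) = 0 := fun q hq => by
    obtain ⟨a1, a2, a3⟩ := hN q hq (along X (along X Φ) q)
    obtain ⟨b1, b2, b3⟩ := hN q hq (along E₂ (along E₂ Φ) q)
    simp only [normalizedMeanCurvature, meanCurvatureVector, h.tensionField_eq hq, mink_smul_left,
      mink_add_left, a1, a2, a3, b1, b2, b3]
    simp
  -- As `n` is orthogonal to `Φ` and to `along Z Φ`, its derivative has no `Φ`-component; `∇^⊥ n =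
  -- 0` then says that the derivative equals its own tangential part.
  have hpar : ∀ q ∈ U, ∀ Z : VField M,
      mink (normalizedMeanCurvature Φ q) (along Z Φ q) = 0 →
      along Z (normalizedMeanCurvature Φ) q =
        mink (along Z (normalizedMeanCurvature Φ) q) (along X Φ q) • along X Φ q +
        mink (along Z (normalizedMeanCurvature Φ) q) (along E₂ Φ q) • along E₂ Φ q :=
    fun q hq Z hZ => by
      have h1 : along Z (normalizedMeanCurvature Φ) q + mink (along Z (normalizedMeanCurvature Φ) q)
          (Φ q) • Φ q - pushVec Φ q (tangentPart Φ q (along Z (normalizedMeanCurvature Φ) q +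
            mink (along Z (normalizedMeanCurvature Φ) q) (Φ q) • Φ q)) = 0 :=
        hΦ.parallel q (Z q)
      rw [h.mink_along_map_of_normal hq (sn q hq) (h.eventually hq fun r hr => (hn r hr).1) hZ,
        zero_smul, add_zero, h.pushVec_tangentPart hq, sub_eq_zero] at h1
      exact h1
  refine ⟨X, U, hpU, { h with
    smooth_f := sf
    smooth_n := sn
    f_pos := fun q _ => hΦ.meanCurvature_pos q
    along_left_f := fun q hq h0 => ?_
    along_right_f := fun q _ => hΦ.mvfderiv_meanCurvature_frameE2 hE₂ q
    n_n := fun q _ => ?_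
    n_map := fun q hq => (hn q hq).1
    n_left := fun q hq => (hn q hq).2.1
    n_right := fun q hq => (hn q hq).2.2
    tension := fun q _ => ?_
    parallel_left := fun q hq => hpar q hq X (hn q hq).2.1
    parallel_right := fun q hq => hpar q hq E₂ (hn q hq).2.2
    biconservative := fun q _ => hΦ.biconservative q }⟩
  · apply hΦ.grad_ne_zero q
    rw [(h.isOrthonormalBasisAt hq).eq_sum (gradM Φ (meanCurvature Φ) q), hgrad, hgrad]
    have h1 : mvfderiv (𝓡 2) (meanCurvature Φ) q (X q) = 0 := h0
    simp [h1, hΦ.mvfderiv_meanCurvature_frameE2 hE₂ q]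
  · have h1 : meanCurvature Φ q * meanCurvature Φ q =
        mink (meanCurvatureVector Φ q) (meanCurvatureVector Φ q) :=
      Real.mul_self_sqrt (hHH q).le
    have h2 := (hΦ.meanCurvature_pos q).ne'
    rw [normalizedMeanCurvature, mink_smul_left, mink_smul_right, ← h1]
    field_simp
  · have h2 := (hΦ.meanCurvature_pos q).ne'
    rw [normalizedMeanCurvature, meanCurvatureVector, smul_smul, smul_smul]
    have : 2 * meanCurvature Φ q * (meanCurvature Φ q)⁻¹ * (1 / 2) = 1 := by field_simp
    rw [this, one_smul]

/-! ### The acceleration field -/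

theorem smooth_push_frameE2 (q : M) : SmoothFnAt (along E₂ Φ) q :=
  (hΦ.smoothFnAt q).along (hE₂.smooth q)

theorem smooth_accelE2 (q : M) : SmoothFnAt (accelE2 Φ E₂) q :=
  (hΦ.smooth_push_frameE2 hE₂ q).along (hE₂.smooth q)

theorem mink_accelE2_push (q : M) : mink (accelE2 Φ E₂ q) (along E₂ Φ q) = 0 := by
  obtain ⟨X, U, hqU, h⟩ := hΦ.exists_adaptedFrame hE₂ q
  exact h.mink_along_right_right hqU

theorem along_accelE2 (q : M) : along E₂ (accelE2 Φ E₂) q =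
    (-mink (accelE2 Φ E₂ q) (accelE2 Φ E₂ q)) • along E₂ Φ q := by
  obtain ⟨X, U, hqU, h⟩ := hΦ.exists_adaptedFrame hE₂ q
  exact h.along_right_accel hqU

variable (ht : ∀ p, mink (accelE2 Φ E₂ p) (accelE2 Φ E₂ p) < 0)
include ht

omit [IsManifold (𝓡 2) ∞ M] hΦ hE₂ in
theorem _root_.kappaHat_eq (q : M) :
    kappaHat Φ E₂ q = √(-mink (accelE2 Φ E₂ q) (accelE2 Φ E₂ q)) := by
  rw [kappaHat, abs_of_neg (ht q)]

omit [IsManifold (𝓡 2) ∞ M] hΦ hE₂ in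
theorem _root_.kappaHat_pos (q : M) : 0 < kappaHat Φ E₂ q := by
  rw [kappaHat_eq ht]
  exact Real.sqrt_pos.2 (neg_pos.2 (ht q))

omit [IsManifold (𝓡 2) ∞ M] hΦ hE₂ in
theorem _root_.kappaHat_mul_self (q : M) : kappaHat Φ E₂ q * kappaHat Φ E₂ q =
    -mink (accelE2 Φ E₂ q) (accelE2 Φ E₂ q) := by
  rw [kappaHat_eq ht]
  exact Real.mul_self_sqrt (neg_pos.2 (ht q)).le

theorem smooth_kappaHat (q : M) : SmoothFnAt (kappaHat Φ E₂) q := by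
  have s := hΦ.smooth_accelE2 hE₂ q
  have h1 : SmoothFnAt (fun r => √(-mink (accelE2 Φ E₂ r) (accelE2 Φ E₂ r))) q :=
    SmoothFnAt.sqrt (s.mink s).neg (neg_pos.2 (ht q)).ne'
  exact h1.congr_of_eventuallyEq (Eventually.of_forall (kappaHat_eq ht))

/-- One has `κ̂² = -⟨W, W⟩`, and `⟨∇̂_Y W, W⟩` is a multiple of `⟨Y, W⟩ = 0`. -/
theorem along_kappaHat (q : M) : along E₂ (kappaHat Φ E₂) q = 0 := by
  have s := hΦ.smooth_accelE2 hE₂ q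
  have sk := hΦ.smooth_kappaHat hE₂ ht q
  have e : (fun r => kappaHat Φ E₂ r * kappaHat Φ E₂ r + mink (accelE2 Φ E₂ r) (accelE2 Φ E₂ r))
      =ᶠ[𝓝 q] fun _ => (0 : ℝ) :=
    Eventually.of_forall fun r => by simp only [kappaHat_mul_self ht]; ring
  have h1 := along_congr (X := E₂) e
  rw [along_add (sk.mul sk) (s.mink s), along_mul sk sk, along_mink s s, along_const,
    hΦ.along_accelE2 hE₂, mink_smul_left, mink_smul_right, mink_comm (along E₂ Φ q),
    hΦ.mink_accelE2_push hE₂] at h1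
  have h2 : kappaHat Φ E₂ q * along E₂ (kappaHat Φ E₂) q = 0 := by linarith
  exact (mul_eq_zero.1 h2).resolve_left (kappaHat_pos ht q).ne'

theorem smooth_xiField (q : M) : SmoothFnAt (xiField Φ E₂) q :=
  ((hΦ.smooth_kappaHat hE₂ ht q).inv (kappaHat_pos ht q).ne').smul (hΦ.smooth_accelE2 hE₂ q)

/-- Timelikeness fixes the sign: `∇̂_Y W = -⟨W, W⟩ Y = κ̂² Y`, to be divided by `κ̂`, which is
constant along `E₂`. A spacelike `W` would give `-κ̂² Y`, hence circles instead of hyperbolas. -/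
theorem along_xiField (q : M) :
    along E₂ (xiField Φ E₂) q = kappaHat Φ E₂ q • along E₂ Φ q := by
  have sx := hΦ.smooth_xiField hE₂ ht q
  have sk := hΦ.smooth_kappaHat hE₂ ht q
  have hk := (kappaHat_pos ht q).ne'
  have e : accelE2 Φ E₂ =ᶠ[𝓝 q] fun r => kappaHat Φ E₂ r • xiField Φ E₂ r :=
    Eventually.of_forall fun r => by
      change accelE2 Φ E₂ r = kappaHat Φ E₂ r • ((kappaHat Φ E₂ r)⁻¹ • accelE2 Φ E₂ r)
      rw [smul_smul, mul_inv_cancel₀ (kappaHat_pos ht r).ne', one_smul]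
  have h1 := along_congr (X := E₂) e
  rw [hΦ.along_accelE2 hE₂, ← kappaHat_mul_self ht, along_smul sk sx,
    hΦ.along_kappaHat hE₂ ht, zero_smul, add_zero, mul_smul] at h1
  exact (smul_right_injective _ hk h1).symm

end IsPNMCBiconservative

end Existence

/-! ### Hyperbolas -/

section Hyperbola

/-- The system has the first integrals `c - ξ/κ`, `cosh(κt) T - sinh(κt) ξ` and `cosh(κt) ξ -
sinh(κt) T`. Solving them for `ξ` by means of `cosh² - sinh² = 1`, and then for `c`, avoids any
uniqueness theorem for differential equations. -/
theorem HasDerivAt.eq_sinh_cosh {E : Type*} [NormedAddCommGroup E] [NormedSpace ℝ E]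
    {c T ξ : ℝ → E} {κ : ℝ} (hκ : κ ≠ 0) {J : Set ℝ} (hJo : IsOpen J) (hJ : J.OrdConnected)
    (h0 : (0 : ℝ) ∈ J) (hc : ∀ v ∈ J, HasDerivAt c (T v) v)
    (hT : ∀ v ∈ J, HasDerivAt T (κ • ξ v) v) (hξ : ∀ v ∈ J, HasDerivAt ξ (κ • T v) v)
    {v : ℝ} (hv : v ∈ J) :
    c v = (c 0 - (1 / κ) • ξ 0) + Real.sinh (κ * v) • ((1 / κ) • T 0) +
      Real.cosh (κ * v) • ((1 / κ) • ξ 0) := by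
  have hconst {g : ℝ → E} (hg : ∀ v ∈ J, HasDerivAt g 0 v) : g v = g 0 :=
    hJo.is_const_of_deriv_eq_zero hJ.isPreconnected
      (fun x hx => (hg x hx).differentiableAt.differentiableWithinAt)
      (fun x hx => (hg x hx).deriv) hv h0
  have hm (v : ℝ) : HasDerivAt (fun t : ℝ => κ * t) κ v := by
    simpa using (hasDerivAt_id v).const_mul κ
  have hs (v : ℝ) : HasDerivAt (fun t => Real.sinh (κ * t)) (Real.cosh (κ * v) * κ) v := (hm v).sinh
  have hch (v : ℝ) : HasDerivAt (fun t => Real.cosh (κ * t)) (Real.sinh (κ * v) * κ) v :=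
    (hm v).cosh
  have e1 := hconst (g := fun t => c t - (1 / κ) • ξ t) fun v hv => by
    refine ((hc v hv).sub ((hξ v hv).const_smul (1 / κ))).congr_deriv ?_
    rw [smul_smul, one_div, inv_mul_cancel₀ hκ, one_smul, sub_self]
  have e2 := hconst (g := fun t => Real.cosh (κ * t) • T t - Real.sinh (κ * t) • ξ t)
    fun v hv => by
      refine (((hch v).smul (hT v hv)).sub ((hs v).smul (hξ v hv))).congr_deriv ?_
      module
  have e3 := hconst (g := fun t => Real.cosh (κ * t) • ξ t - Real.sinh (κ * t) • T t)
    fun v hv => by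
      refine (((hch v).smul (hξ v hv)).sub ((hs v).smul (hT v hv))).congr_deriv ?_
      module
  simp only [mul_zero, Real.cosh_zero, Real.sinh_zero, one_smul, zero_smul, sub_zero] at e1 e2 e3
  have hid : Real.cosh (κ * v) ^ 2 - Real.sinh (κ * v) ^ 2 = 1 := Real.cosh_sq_sub_sinh_sq _
  have hξv : ξ v = Real.sinh (κ * v) • T 0 + Real.cosh (κ * v) • ξ 0 := by
    rw [← e2, ← e3]
    calc ξ v = (Real.cosh (κ * v) ^ 2 - Real.sinh (κ * v) ^ 2) • ξ v := by rw [hid, one_smul]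
      _ = _ := by module
  rw [← e1, hξv]
  module

theorem isLorentzianPlane_span_pair {a b : Mink5} (ha : mink a a = 1) (hb : mink b b = -1)
    (hab : mink a b = 0) : IsLorentzianPlane (Submodule.span ℝ {a, b}) := by
  refine ⟨?_, a, b, rfl, ha, hb, hab⟩
  have hli : LinearIndependent ℝ ![a, b] := by
    rw [LinearIndependent.pair_iff]
    intro s t hst
    have h1 := congrArg (fun x => mink x a) hst
    have h2 := congrArg (fun x => mink x b) hst
    simp only [mink_add_left, mink_smul_left, ha, hb, hab, mink_comm b a, mink_zero_left] at h1 h2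
    constructor <;> linarith
  have := finrank_span_eq_card hli
  rwa [Matrix.range_cons_cons_empty, Fintype.card_fin] at this

theorem isLorentzianPlane_span_smul_pair {a b : Mink5} {c : ℝ} (hc : c ≠ 0)
    (ha : mink a a = 1) (hb : mink b b = -1) (hab : mink a b = 0) :
    IsLorentzianPlane (Submodule.span ℝ {c • a, c • b}) := by
  have : Submodule.span ℝ {c • a, c • b} = Submodule.span ℝ {a, b} := by
    rw [← Submodule.span_smul_eq_of_isUnit {a, b} c (isUnit_iff_ne_zero.2 hc), Set.smul_set_insert,
      Set.smul_set_singleton]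
  rw [this]
  exact isLorentzianPlane_span_pair ha hb hab

end Hyperbola

/-! ### Derivatives along integral curves -/

section IntegralCurve

variable {M : Type*} [TopologicalSpace M] [ChartedSpace (EuclideanSpace ℝ (Fin 2)) M]

theorem IsMIntegralCurveOn.hasDerivAt_comp {F : Type*} [NormedAddCommGroup F] [NormedSpace ℝ F]
    [IsManifold (𝓡 2) ∞ M]
    {γ : ℝ → M} {X : VField M} {J : Set ℝ} (hγ : IsMIntegralCurveOn γ X J) (hJ : IsOpen J)
    {V : M → F} {t : ℝ} (ht : t ∈ J) (hV : SmoothFnAt V (γ t)) :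
    HasDerivAt (fun s => V (γ s)) (along X V (γ t)) t := by
  have h1 := (hγ t ht).hasMFDerivAt (hJ.mem_nhds ht)
  have h2 : HasFDerivAt (𝕜 := ℝ) (E := ℝ) (F := F) (fun s => V (γ s)) _ t :=
    (hV.mdiff.hasMFDerivAt.comp t h1).hasFDerivAt
  refine h2.hasDerivAt.congr_deriv ?_
  change mfderiv (𝓡 2) 𝓘(ℝ, F) V (γ t) ((1 : ℝ) • X (γ t)) =
    mfderiv (𝓡 2) 𝓘(ℝ, F) V (γ t) (X (γ t))
  rw [one_smul]

end IntegralCurve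

/-! ### Proof of the theorem -/

theorem mainTheorem7 {M : Type*} [TopologicalSpace M] [T2Space M] [SecondCountableTopology M]
    [ConnectedSpace M] [ChartedSpace (EuclideanSpace ℝ (Fin 2)) M] [IsManifold (𝓡 2) ∞ M]
    (Φ : M → Mink5) (hΦ : IsPNMCBiconservative Φ)
    (E₂ : VField M) (hE₂ : IsFrameE2 Φ E₂)
    (htimelike : ∀ p, mink (accelE2 Φ E₂ p) (accelE2 Φ E₂ p) < 0)
    (γ : ℝ → M) (J : Set ℝ) (hJopen : IsOpen J) (hJ : J.OrdConnected) (h0 : (0 : ℝ) ∈ J)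
    (hγ : IsMIntegralCurveOn γ E₂ J) :
    (∀ p, MDifferentiableAt (𝓡 2) 𝓘(ℝ, Mink5) (xiField Φ E₂) p ∧
      covHat (xiField Φ E₂) p (E₂ p) = kappaHat Φ E₂ p • pushVec Φ p (E₂ p)) ∧
    ∃ κ : ℝ, 0 < κ ∧
      (∀ v ∈ J, kappaHat Φ E₂ (γ v) = κ ∧ curveCurvature (Φ ∘ γ) v = κ) ∧
      ∃ B₀ B₁ B₂ : Mink5,
        B₀ = Φ (γ 0) - (1 / κ) • xiField Φ E₂ (γ 0) ∧
        B₁ = (1 / κ) • pushVec Φ (γ 0) (E₂ (γ 0)) ∧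
        B₂ = (1 / κ) • xiField Φ E₂ (γ 0) ∧
        (∀ v ∈ J, Φ (γ v) = B₀ + Real.sinh (κ * v) • B₁ + Real.cosh (κ * v) • B₂) ∧
        mink B₁ B₂ = 0 ∧ mink B₁ B₁ = 1 / κ ^ 2 ∧ -mink B₂ B₂ = 1 / κ ^ 2 ∧
        IsLorentzianPlane (Submodule.span ℝ {B₁, B₂}) ∧
        (∀ v ∈ J, Φ (γ v) ∈ AffineSubspace.mk' B₀ (Submodule.span ℝ {B₁, B₂})) ∧
        (Φ ∘ γ) '' J ⊆ hyperbolaBranch B₀ B₁ B₂ ∧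
        (J = Set.univ → (Φ ∘ γ) '' J = hyperbolaBranch B₀ B₁ B₂) := by
  have hacc (q : M) : accelE2 Φ E₂ q = kappaHat Φ E₂ q • xiField Φ E₂ q := by
    rw [xiField, smul_smul, mul_inv_cancel₀ (kappaHat_pos htimelike q).ne', one_smul]
  refine ⟨fun p => ⟨(hΦ.smooth_xiField hE₂ htimelike p).mdiff,
    hΦ.along_xiField hE₂ htimelike p⟩, kappaHat Φ E₂ (γ 0), kappaHat_pos htimelike _, ?_⟩
  set κ := kappaHat Φ E₂ (γ 0) with hκ_def
  have hκ : 0 < κ := kappaHat_pos htimelike _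
  have hκγ : ∀ v ∈ J, kappaHat Φ E₂ (γ v) = κ := fun v hv =>
    hJopen.is_const_of_deriv_eq_zero hJ.isPreconnected
      (f := fun v => kappaHat Φ E₂ (γ v))
      (fun x hx => (hγ.hasDerivAt_comp hJopen hx
        (hΦ.smooth_kappaHat hE₂ htimelike _)).differentiableAt.differentiableWithinAt)
      (fun x hx => (hγ.hasDerivAt_comp hJopen hx
        (hΦ.smooth_kappaHat hE₂ htimelike _)).deriv.trans (hΦ.along_kappaHat hE₂ htimelike _))
      hv h0
  have hc : ∀ v ∈ J, HasDerivAt (Φ ∘ γ) (along E₂ Φ (γ v)) v := fun v hv =>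
    hγ.hasDerivAt_comp hJopen hv (hΦ.smoothFnAt _)
  have hT : ∀ v ∈ J, HasDerivAt (fun s => along E₂ Φ (γ s)) (accelE2 Φ E₂ (γ v)) v :=
    fun v hv => hγ.hasDerivAt_comp hJopen hv (hΦ.smooth_push_frameE2 hE₂ _)
  have hξ : ∀ v ∈ J, HasDerivAt (fun s => xiField Φ E₂ (γ s)) (κ • along E₂ Φ (γ v)) v :=
    fun v hv => (hγ.hasDerivAt_comp hJopen hv (hΦ.smooth_xiField hE₂ htimelike _)).congr_deriv
      (by rw [hΦ.along_xiField hE₂ htimelike, hκγ v hv])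
  have hT' : ∀ v ∈ J, HasDerivAt (fun s => along E₂ Φ (γ s)) (κ • xiField Φ E₂ (γ v)) v :=
    fun v hv => (hT v hv).congr_deriv (by rw [hacc, hκγ v hv])
  have hcurve (v : ℝ) (hv : v ∈ J) :=
    HasDerivAt.eq_sinh_cosh hκ.ne' hJopen hJ h0 hc hT' hξ hv
  have hTT : mink (along E₂ Φ (γ 0)) (along E₂ Φ (γ 0)) = 1 := hE₂.unit _
  have hξξ : mink (xiField Φ E₂ (γ 0)) (xiField Φ E₂ (γ 0)) = -1 := by
    have h1 := kappaHat_mul_self htimelike (γ 0)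
    rw [hacc, mink_smul_left, mink_smul_right, ← hκ_def] at h1
    have h2 : κ * κ * (mink (xiField Φ E₂ (γ 0)) (xiField Φ E₂ (γ 0)) + 1) = 0 := by linarith
    have := (mul_eq_zero.1 h2).resolve_left (mul_pos hκ hκ).ne'
    linarith
  have hTξ : mink (along E₂ Φ (γ 0)) (xiField Φ E₂ (γ 0)) = 0 := by
    rw [xiField, mink_smul_right, mink_comm, hΦ.mink_accelE2_push hE₂, mul_zero]
  refine ⟨fun v hv => ⟨hκγ v hv, ?_⟩, _, _, _, rfl, rfl, rfl, hcurve, ?_, ?_, ?_, ?_, ?_, ?_, ?_⟩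
  · have h1 : deriv (Φ ∘ γ) =ᶠ[𝓝 v] fun s => along E₂ Φ (γ s) := by
      filter_upwards [hJopen.mem_nhds hv] with s hs using (hc s hs).deriv
    rw [curveCurvature, h1.deriv_eq, (hT v hv).deriv]
    exact hκγ v hv
  · rw [mink_smul_left, mink_smul_right]
    exact mul_eq_zero_of_right _ (mul_eq_zero_of_right _ hTξ)
  · rw [mink_smul_left, mink_smul_right]
    change _ * (_ * mink (along E₂ Φ (γ 0)) (along E₂ Φ (γ 0))) = _
    rw [hTT]
    ring
  · rw [mink_smul_left, mink_smul_right, hξξ]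
    ring
  · exact isLorentzianPlane_span_smul_pair (one_div_pos.2 hκ).ne' hTT hξξ hTξ
  · intro v hv
    change (Φ ∘ γ) v ∈ _
    rw [AffineSubspace.mem_mk', hcurve v hv, vsub_eq_sub, add_assoc]
    change Φ (γ 0) - _ + _ - _ ∈ _
    rw [add_sub_cancel_left]
    exact Submodule.add_mem _
      (Submodule.smul_mem _ _ (Submodule.subset_span (Set.mem_insert _ _)))
      (Submodule.smul_mem _ _ (Submodule.subset_span (Set.mem_insert_of_mem _ rfl)))
  · rintro _ ⟨v, hv, rfl⟩
    exact ⟨_, _, Real.cosh_sq_sub_sinh_sq _, Real.cosh_pos _, hcurve v hv⟩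
  · rintro rfl
    refine Set.Subset.antisymm ?_ ?_
    · rintro _ ⟨v, hv, rfl⟩
      exact ⟨_, _, Real.cosh_sq_sub_sinh_sq _, Real.cosh_pos _, hcurve v hv⟩
    · rintro _ ⟨x, y, hxy, hy, rfl⟩
      -- The parameter is forced by `sinh(κv) = x`; then `cosh(κv) = √(1 + x²)` equals `y` because
      -- `y > 0`.
      refine ⟨Real.arsinh x / κ, Set.mem_univ _, ?_⟩
      have hx : κ * (Real.arsinh x / κ) = Real.arsinh x := mul_div_cancel₀ _ hκ.ne'
      have hyx : Real.cosh (Real.arsinh x) = y := by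
        rw [Real.cosh_arsinh, ← Real.sqrt_sq hy.le]
        congr 1
        linarith
      refine (hcurve _ (Set.mem_univ _)).trans ?_
      rw [hx, Real.sinh_arsinh, hyx]
      rfl
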